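/- **Conventions.** Let $(M,g)$ be a Riemannian manifold and $\phi,\psi:M\to\mathbb C$ smooth functions, and extend $g$ complex-bilinearly to the complexified tangent bundle. The tension field (Laplace–Beltrami operator) and the conformality operator are, in local coordinates, $$\tau(\phi)=\operatorname{div}(\nabla\phi)=\frac1{\sqrt{|g|}}\sum_{i,j}\frac{\partial}{\partial x_j}\Big(g^{ij}\sqrt{|g|}\,\frac{\partial\phi}{\partial x_i}\Big),\qquad \kappa(\phi,\psi)=g(\nabla\phi,\nabla\psi).$$ Put $J_n=\begin{bmatrix}0&I_n\\-I_n&0\end{bmatrix}$ and $I_{p,q}=\begin{bmatrix}-I_p&0\\0&I_q\end{bmatrix}$. For $n\ge1$, $p,q\ge0$ with $p+q\ge1$, consider the groups - $\mathbf{SL}(n,\mathbb R)=\{x\in\mathbb R^{n\times n}: \det x=1\}$, $\ \mathbf{SO}(n)=\{x\in\mathbb R^{n\times n}: xx^t=I_n,\ \det x=1\}$, $\ \mathbf{SU}(n)=\{z\in\mathbb C^{n\times n}: zz^*=I_n,\ \det z=1\}$; - $\mathbf{SO}(p,q)=\{x\in\mathbb R^{(p+q)\times(p+q)}: xI_{p,q}x^t=I_{p,q},\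 \det x=1\}$, $\ \mathbf{SU}(p,q)=\{z\in\mathbb C^{(p+q)\times(p+q)}: zI_{p,q}z^*=I_{p,q},\ \det z=1\}$; - $\mathbf{Sp}(n)=\{q\in\mathbb H^{n\times n}: qq^*=I_n\}$ and $\mathbf{Sp}(p,q)=\{q\in\mathbb H^{(p+q)\times(p+q)}: qI_{p,q}q^*=I_{p,q}\}$, both regarded as groups of complex matrices of twice the size through the standard representation of quaternionic matrices $z+wj\mapsto\begin{bmatrix}z&w\\-\bar w&\bar z\end{bmatrix}$ ($z,w$ complex matrices); - $\mathbf{Sp}(n,\mathbb R)=\{q\in\mathbb R^{2n\times2n}: \det q=1,\ qJ_nq^t=J_n\}$, with elements written in $n\times n$ blocks as $q=\begin{bmatrix}x&y\\z&w\end{bmatrix}$; - $\mathbf{SO}^*(2n)=\{q\in\mathbf{SU}(n,n): qI_{n,n}J_nq^t=I_{n,n}J_n\}$, whose elements have the form $q=\begin{bmatrix}z&w\\-\bar w&\bar z\end{bmatrix}$ with $z,w\in\mathbb C^{n\times n}$; - $\mathbf{SU}^*(2n)=\Big\{\begin{bmatrix}z&w\\-\bar w&\bar z\end{bmatrix}: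 z,w\in\mathbb C^{n\times n}\Big\}\cap\mathbf{SL}(2n,\mathbb C)$. Each group carries the left-invariant Riemannian metric induced by the inner product $g(Z,W)=\operatorname{Re}\operatorname{tr}(ZW^*)$ on its Lie algebra (a real Lie algebra of real or complex matrices). Vectors are row vectors, so $a^tv$ is the matrix with entries $a_iv_j$; $v$ is isotropic if $\sum_iv_i^2=0$; and $\mathbb C^p_1=\{(z,w)\in\mathbb C^p\times\mathbb C^q: w=0\}$, $\mathbb C^q_2=\{(z,w)\in\mathbb C^p\times\mathbb C^q: z=0\}$. **Theorem.** In each of the following cases the function $\phi$ on the given group satisfies $\tau(\phi)=\lambda\,\phi$ and $\kappa(\phi,\phi)=\mu\,\phi^2$ with the given constants. 1. $\mathbf{SL}(n,\mathbb R)$: $\phi(x)=\operatorname{tr}(Ax^t)$ with $A\in\mathbb C^{n\times n}$, $AA^t=0$; $\ \lambda=\frac{n-1}{n}$, $\mu=-\frac1n$. 2. $\mathbf{SO}(n)$: $\phi(x)=\operatorname{tr}(a^tvx^t)$ with $a,v\in\mathbb C^n$, $v$ isotropic; $\ \lambda=-\frac{n-1}2$, $\mu=-\frac12$. 3. $\mathbf{SU}(n)$: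 $\phi(z)=\operatorname{tr}(a^tvz^t)$ with $a,v\in\mathbb C^n$; $\ \lambda=-\frac{n^2-1}n$, $\mu=-\frac{n-1}n$. 4. $\mathbf{Sp}(n)$: $\phi(q)=\operatorname{tr}(a^tvz^t+a^tuw^t)$ with $a,v,u\in\mathbb C^n$; $\ \lambda=-\frac{2n+1}2$, $\mu=-\frac12$. 5. $\mathbf{SO}(p,q)$: $\phi(x)=\operatorname{tr}(a^tvx^t)$ with $a\in\mathbb C^{p+q}$ and $v$ isotropic; $\mu=-\frac12$, and $\lambda=\frac{q-p+1}2$ if $v\in\mathbb C^p_1$, $\ \lambda=\frac{p-q+1}2$ if $v\in\mathbb C^q_2$. 6. $\mathbf{SU}(p,q)$: $\phi(z)=\operatorname{tr}(a^tvz^t)$ with $a\in\mathbb C^{p+q}$; $\mu=-\frac{p+q-1}{p+q}$, and $\lambda=\frac{q^2-p^2+1}{p+q}$ if $v\in\mathbb C^p_1$, $\ \lambda=\frac{p^2-q^2+1}{p+q}$ if $v\in\mathbb C^q_2$. 7. $\mathbf{Sp}(p,q)$: $\phi(q)=\operatorname{tr}(a^tvz^t+a^tuw^t)$ with $a\in\mathbb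 C^{p+q}$; $\mu=-\frac12$, and $\lambda=-\frac{2(p-q)+1}2$ if $v,u\in\mathbb C^p_1$, $\ \lambda=-\frac{2(q-p)+1}2$ if $v,u\in\mathbb C^q_2$. 8. $\mathbf{Sp}(n,\mathbb R)$: $\phi(q)=\operatorname{tr}(a^tv(x+iy)^t)$ or $\phi(q)=\operatorname{tr}(a^tv(z+iw)^t)$ with $a,v\in\mathbb C^n$; $\ \lambda=\frac12$, $\mu=-\frac12$. 9. $\mathbf{SO}^*(2n)$: $\phi(q)=\operatorname{tr}(a^tvz^t)$ or $\phi(q)=\operatorname{tr}(a^tvw^t)$ with $a,v\in\mathbb C^n$; $\ \lambda=-\frac12$, $\mu=-\frac12$. 10. $\mathbf{SU}^*(2n)$: $\phi(q)=\operatorname{tr}(Az^t+Bw^t)$ with $A,B\in\mathbb C^{n\times n}$, $AB^t=BA^t$; $\ \lambda=-\frac{2n+1}{2n}$, $\mu=-\frac1{2n}$. -/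

import Mathlib

open scoped Matrix Quaternion

namespace EigenLie

noncomputable section

/-! ## Gradient, tension field and conformality operator in local coordinates -/

/-- The partial derivative `∂f/∂xᵢ` at `x` of a function on a coordinate domain in `ℝᵈ`. -/
def pderiv {𝕜 : Type*} [RCLike 𝕜] {d : ℕ} (i : Fin d) (f : (Fin d → ℝ) → 𝕜)
    (x : Fin d → ℝ) : 𝕜 :=
  fderiv ℝ f x (Pi.single i 1)

/-- The coordinates `(∇f)ⁱ = ∑ⱼ gⁱʲ ∂f/∂xⱼ` of the gradient of `f`, where `g` is the coefficient
matrix of a Riemannian metric in local coordinates. -/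
def coordGradient {d : ℕ} (g : (Fin d → ℝ) → Matrix (Fin d) (Fin d) ℝ)
    (f : (Fin d → ℝ) → ℂ) (x : Fin d → ℝ) (i : Fin d) : ℂ :=
  ∑ j, (((g x)⁻¹ i j : ℝ) : ℂ) * pderiv j f x

/-- The Laplace-Beltrami operator in local coordinates,
`τ(f) = |g|^(-1/2) ∑ⱼ ∂/∂xⱼ (∑ᵢ gⁱʲ |g|^(1/2) ∂f/∂xᵢ)`. -/
def coordTension {d : ℕ} (g : (Fin d → ℝ) → Matrix (Fin d) (Fin d) ℝ)
    (f : (Fin d → ℝ) → ℂ) (x : Fin d → ℝ) : ℂ :=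
  ((1 / √(g x).det : ℝ) : ℂ) *
    ∑ j, pderiv j (fun y => ((√(g y).det : ℝ) : ℂ) * coordGradient g f y j) x

/-- The conformality operator `κ(f, h) = g(∇f, ∇h)` in local coordinates, where `g` is extended
complex-bilinearly. -/
def coordConformality {d : ℕ} (g : (Fin d → ℝ) → Matrix (Fin d) (Fin d) ℝ)
    (f h : (Fin d → ℝ) → ℂ) (x : Fin d → ℝ) : ℂ :=
  ∑ i, ∑ j, ((g x i j : ℝ) : ℂ) * coordGradient g f x i * coordGradient g h x j

/-! ## Matrix Lie groups with their canonical left-invariant metric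

In this part `G` is a closed subgroup of a general linear group over `ℝ` or `ℂ`, given as a set of
matrices. -/

/-- The inner product `g(Z, W) = Re tr(Z W*)`. -/
def innerForm {𝕜 ι : Type*} [RCLike 𝕜] [Fintype ι] (Z W : Matrix ι ι 𝕜) : ℝ :=
  RCLike.re (Z * Wᴴ).trace

/-- The left-invariant extension of `innerForm`, evaluated on vectors `Z, W` tangent at `p`. -/
def leftInvariantMetric {𝕜 ι : Type*} [RCLike 𝕜] [Fintype ι] [DecidableEq ι]
    (p Z W : Matrix ι ι 𝕜) : ℝ :=
  innerForm (p⁻¹ * Z) (p⁻¹ * W)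

/-- The Lie algebra of `G`, consisting of all `X` with `exp(tX) ∈ G` for all real `t`. For a closed
subgroup `G` these `X` already form a real subspace, so the span adds nothing. -/
def lieAlgebra {𝕜 ι : Type*} [RCLike 𝕜] [Fintype ι] [DecidableEq ι]
    (G : Set (Matrix ι ι 𝕜)) : Submodule ℝ (Matrix ι ι 𝕜) :=
  Submodule.span ℝ {X | ∀ t : ℝ, NormedSpace.exp (t • X) ∈ G}

/-- The local parametrization `x ↦ p exp(∑ᵢ xᵢ eᵢ)` of `G` around `p ∈ G`, where `(eᵢ)` is a basis
of the Lie algebra of `G`. It maps `0` to `p`, and it is a diffeomorphism from a neighbourhood of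
`0` onto a neighbourhood of `p` in `G`. -/
def expChart {𝕜 ι : Type*} [RCLike 𝕜] [Fintype ι] [DecidableEq ι]
    (G : Set (Matrix ι ι 𝕜)) (p : Matrix ι ι 𝕜)
    (x : Fin (Module.finrank ℝ (lieAlgebra G)) → ℝ) : Matrix ι ι 𝕜 :=
  p * NormedSpace.exp
    (∑ i, x i • ((Module.finBasis ℝ (lieAlgebra G) i : lieAlgebra G) : Matrix ι ι 𝕜))

/-- The `i`-th coordinate vector field of the parametrization `expChart G p` at `x`, as a matrix
(computed entrywise). -/
def coordVector {𝕜 ι : Type*} [RCLike 𝕜] [Fintype ι] [DecidableEq ι]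
    (G : Set (Matrix ι ι 𝕜)) (p : Matrix ι ι 𝕜)
    (x : Fin (Module.finrank ℝ (lieAlgebra G)) → ℝ)
    (i : Fin (Module.finrank ℝ (lieAlgebra G))) : Matrix ι ι 𝕜 :=
  Matrix.of fun r s => pderiv i (fun y => expChart G p y r s) x

/-- The coefficients `gᵢⱼ` of the left-invariant metric on `G` in the coordinates
`expChart G p`. -/
def metricCoeff {𝕜 ι : Type*} [RCLike 𝕜] [Fintype ι] [DecidableEq ι]
    (G : Set (Matrix ι ι 𝕜)) (p : Matrix ι ι 𝕜)
    (x : Fin (Module.finrank ℝ (lieAlgebra G)) → ℝ) :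
    Matrix (Fin (Module.finrank ℝ (lieAlgebra G))) (Fin (Module.finrank ℝ (lieAlgebra G))) ℝ :=
  Matrix.of fun i j =>
    leftInvariantMetric (expChart G p x) (coordVector G p x i) (coordVector G p x j)

/-- The tension field `τ(φ)` at `p ∈ G` of a function `φ` on `G` (only the values of `φ` on `G`
matter). The coordinate expression of the Laplace-Beltrami operator does not depend on the
coordinates; it is evaluated at `p` in the coordinates `expChart G p` centred at `p`. -/
def tension {𝕜 ι : Type*} [RCLike 𝕜] [Fintype ι] [DecidableEq ι]
    (G : Set (Matrix ι ι 𝕜)) (φ : Matrix ι ι 𝕜 → ℂ) (p : Matrix ι ι 𝕜) : ℂ :=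
  coordTension (metricCoeff G p) (fun x => φ (expChart G p x)) 0

/-- The conformality operator `κ(φ, ψ)` at `p ∈ G` of functions `φ, ψ` on `G`. -/
def conformality {𝕜 ι : Type*} [RCLike 𝕜] [Fintype ι] [DecidableEq ι]
    (G : Set (Matrix ι ι 𝕜)) (φ ψ : Matrix ι ι 𝕜 → ℂ) (p : Matrix ι ι 𝕜) : ℂ :=
  coordConformality (metricCoeff G p) (fun x => φ (expChart G p x))
    (fun x => ψ (expChart G p x)) 0

/-- `φ` satisfies `τ(φ) = lam φ` and `κ(φ, φ) = mu φ²` on `G`. -/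
def IsEigenfunction {𝕜 ι : Type*} [RCLike 𝕜] [Fintype ι] [DecidableEq ι]
    (G : Set (Matrix ι ι 𝕜)) (φ : Matrix ι ι 𝕜 → ℂ) (lam mu : ℂ) : Prop :=
  ∀ p ∈ G, tension G φ p = lam * φ p ∧ conformality G φ φ p = mu * φ p ^ 2

/-! ## The classical groups -/

/-- `I_{p,q} = diag(-I_p, I_q)`. -/
def Ipq (R : Type*) [Ring R] (p q : ℕ) : Matrix (Fin p ⊕ Fin q) (Fin p ⊕ Fin q) R :=
  Matrix.fromBlocks (-1) 0 0 1

/-- `J_n`, with blocks `0, I_n, -I_n, 0`. -/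
def Jn (R : Type*) [Ring R] (n : ℕ) : Matrix (Fin n ⊕ Fin n) (Fin n ⊕ Fin n) R :=
  Matrix.fromBlocks 0 1 (-1) 0

/-- `SL(n, ℝ)`. -/
def SLR (n : ℕ) : Set (Matrix (Fin n) (Fin n) ℝ) := {x | x.det = 1}

/-- `SO(n)`. -/
def SO (n : ℕ) : Set (Matrix (Fin n) (Fin n) ℝ) := {x | x * xᵀ = 1 ∧ x.det = 1}

/-- `SU(n)`. -/
def SU (n : ℕ) : Set (Matrix (Fin n) (Fin n) ℂ) := {z | z * zᴴ = 1 ∧ z.det = 1}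

/-- `SO(p, q)`. -/
def SOpq (p q : ℕ) : Set (Matrix (Fin p ⊕ Fin q) (Fin p ⊕ Fin q) ℝ) :=
  {x | x * Ipq ℝ p q * xᵀ = Ipq ℝ p q ∧ x.det = 1}

/-- `SU(p, q)`. -/
def SUpq (p q : ℕ) : Set (Matrix (Fin p ⊕ Fin q) (Fin p ⊕ Fin q) ℂ) :=
  {z | z * Ipq ℂ p q * zᴴ = Ipq ℂ p q ∧ z.det = 1}

/-- The block matrix with rows `(z, w)` and `(-w̄, z̄)`. -/
def quatBlock {ι : Type*} (z w : Matrix ι ι ℂ) : Matrix (ι ⊕ ι) (ι ⊕ ι) ℂ :=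
  Matrix.fromBlocks z w (-(w.map (starRingEnd ℂ))) (z.map (starRingEnd ℂ))

/-- The standard complex representation of quaternionic matrices: writing `q = z + w j` with
complex matrices `z = q₀ + q₁ i` and `w = q₂ + q₃ i`, it sends `q` to `quatBlock z w`. -/
def quatRep {ι : Type*} (q : Matrix ι ι ℍ[ℝ]) : Matrix (ι ⊕ ι) (ι ⊕ ι) ℂ :=
  quatBlock (q.map fun h => (⟨h.re, h.imI⟩ : ℂ)) (q.map fun h => (⟨h.imJ, h.imK⟩ : ℂ))

/-- `Sp(n) = {q ∈ GL(n, ℍ) | q q* = I}`, in the standard complex representation. -/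
def Sp (n : ℕ) : Set (Matrix (Fin n ⊕ Fin n) (Fin n ⊕ Fin n) ℂ) :=
  quatRep '' {q : Matrix (Fin n) (Fin n) ℍ[ℝ] | q * qᴴ = 1}

/-- `Sp(p, q) = {q ∈ GL(p + q, ℍ) | q I_{p,q} q* = I_{p,q}}`, in the standard complex
representation. -/
def Sppq (p q : ℕ) : Set (Matrix ((Fin p ⊕ Fin q) ⊕ (Fin p ⊕ Fin q))
    ((Fin p ⊕ Fin q) ⊕ (Fin p ⊕ Fin q)) ℂ) :=
  quatRep '' {x : Matrix (Fin p ⊕ Fin q) (Fin p ⊕ Fin q) ℍ[ℝ] |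
    x * Ipq ℍ[ℝ] p q * xᴴ = Ipq ℍ[ℝ] p q}

/-- `Sp(n, ℝ)`, as a subgroup of `SL(2n, ℝ)`. -/
def SpR (n : ℕ) : Set (Matrix (Fin n ⊕ Fin n) (Fin n ⊕ Fin n) ℝ) :=
  {q | q.det = 1 ∧ q * Jn ℝ n * qᵀ = Jn ℝ n}

/-- `SO*(2n)`, as a subgroup of `SU(n, n)`. -/
def SOStar (n : ℕ) : Set (Matrix (Fin n ⊕ Fin n) (Fin n ⊕ Fin n) ℂ) :=
  {q | q ∈ SUpq n n ∧ q * (Ipq ℂ n n * Jn ℂ n) * qᵀ = Ipq ℂ n n * Jn ℂ n}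

/-- `SU*(2n)`, the matrices of the form `quatBlock z w` of determinant one. -/
def SUStar (n : ℕ) : Set (Matrix (Fin n ⊕ Fin n) (Fin n ⊕ Fin n) ℂ) :=
  {Q | (∃ z w : Matrix (Fin n) (Fin n) ℂ, Q = quatBlock z w) ∧ Q.det = 1}

/-! ## Vectors -/

/-- `v ∈ ℂⁿ` is isotropic: `∑ᵢ vᵢ² = 0`. -/
def Isotropic {ι : Type*} [Fintype ι] (v : ι → ℂ) : Prop := v ⬝ᵥ v = 0

/-- `ℂ₁ᵖ = {(z, w) ∈ ℂᵖ × ℂ^q | w = 0}`. -/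
def C1 (p q : ℕ) : Set (Fin p ⊕ Fin q → ℂ) := {v | ∀ j, v (Sum.inr j) = 0}

/-- `ℂ₂^q = {(z, w) ∈ ℂᵖ × ℂ^q | z = 0}`. -/
def C2 (p q : ℕ) : Set (Fin p ⊕ Fin q → ℂ) := {v | ∀ i, v (Sum.inl i) = 0}

/-- A real matrix, regarded as a complex one. -/
def toC {m n : Type*} (x : Matrix m n ℝ) : Matrix m n ℂ := x.map fun r => (r : ℂ)

/-- `aᵗ v` for row vectors `a, v`: the matrix with entries `aᵢ vⱼ`. -/
def outer {ι : Type*} (a v : ι → ℂ) : Matrix ι ι ℂ := Matrix.of fun i j => a i * v j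

end

end EigenLie

/-!
The functions in question are restrictions of linear functions `L(X) = tr(M Xᵗ)` to a group `G` of
matrices. Two general facts reduce the theorem to finite sums.

*Reduction to the Lie algebra.* In the exponential coordinates around `p ∈ G` the left Maurer-Cartan
form is `v - [x, v] / 2` to first order (`hasFDerivAt_maurerCartan`), which gives the first
derivatives of the metric coefficients at `0`. The Lie algebras at hand are stable under conjugate
transposition, hence unimodular (`sum_gram_inv_mul_innerForm_comm`), and so the coordinates are
harmonic at `0` and the first-order terms of the Laplace-Beltrami operator vanish there
(`coordTension_zero_eq`). As the second derivative of `exp` at `0` is the symmetrized product, for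
an orthonormal basis `Eᵢ` of the Lie algebra
`τ(L)(p) = ∑ᵢ L(p Eᵢ²)` and `κ(L, L)(p) = ∑ᵢ L(p Eᵢ)²`
(`tension_eq_gramSum`, `conformality_eq_gramSum`).

*Summation over all matrices.* If `P` is the orthogonal projection of the space of all matrices onto
the Lie algebra, then `∑ᵢ β(Eᵢ, Eᵢ) = ∑ β(PY, Y)` with `Y` running through the matrix units and, in
the complex case, their multiples by `i` (`gramSum_eq_frameSum`). The defining equations of the
classical groups say that certain commuting involutions fix the Lie algebra: `Y ↦ -K Y* K*` for
`x K x* = K`, and `Y ↦ -J Ȳ J` for `x J = J x̄`. So `P` is a product of projections `(1 + θ) / 2`,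
from which the projection onto the multiples of `1` or of `i` is subtracted where the determinant
imposes a condition of its own. Both sums are linear in `P`, and each of the involutions contributes
an elementary sum over matrix units: the Casimir element `∑ (PY) Y` is a combination of `1` and `K`,
and `M` is an eigenvector of `K`; in the second sum, `M Mᵗ = 0` or `M J Mᵗ = 0` kills the terms that
are not multiples of `L(p)²`, and for `M = aᵗv` of rank one the involution coming from `K`
contributes a multiple of `L(p)²` (`trace_outer_sq`). This is carried out for five families of
groups (`isEigenfunction_specialLinear`, `isEigenfunction_orthogonal`,
`isEigenfunction_specialUnitary`, `isEigenfunction_quaternionic`,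
`isEigenfunction_quaternionicSpecialLinear`), of which the groups in the theorem are special cases.
-/

namespace EigenLie

noncomputable section

/-! ### Second-order behaviour of the exponential map -/

section CoordSum

variable {A : Type*} [NormedAddCommGroup A] [NormedSpace ℝ A] {d : ℕ} (b : Fin d → A)

theorem hasFDerivAt_coordSum (x : Fin d → ℝ) :
    HasFDerivAt (fun y : Fin d → ℝ => ∑ i, y i • b i)
      (∑ i, (ContinuousLinearMap.proj (R := ℝ) (φ := fun _ : Fin d => ℝ) i).smulRight (b i)) x :=
  HasFDerivAt.fun_sum fun i _ => (hasFDerivAt_apply i x).smul_const (b i)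

theorem coordSum_single (j : Fin d) :
    (∑ i, (ContinuousLinearMap.proj (R := ℝ) (φ := fun _ : Fin d => ℝ) i).smulRight (b i))
      (Pi.single j 1) = b j := by
  rw [sum_apply]
  refine (Finset.sum_eq_single j (fun i _ hi => ?_) (by simp)).trans ?_
  · simp [hi]
  · simp

end CoordSum

section Exponential

variable {A : Type*} [NormedRing A] [NormedAlgebra ℝ A] [CompleteSpace A]

theorem contDiff_exp : ContDiff ℝ 2 (NormedSpace.exp : A → A) :=
  contDiff_iff_contDiffAt.2 fun x => (NormedSpace.exp_analytic (𝕂 := ℝ) x).contDiffAt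

theorem differentiable_exp : Differentiable ℝ (NormedSpace.exp : A → A) :=
  contDiff_exp.differentiable two_ne_zero

theorem differentiable_fderiv_exp : Differentiable ℝ (fderiv ℝ (NormedSpace.exp : A → A)) :=
  (contDiff_exp.fderiv_right (m := 1) (by norm_num)).differentiable one_ne_zero

theorem fderiv_exp_zero : fderiv ℝ (NormedSpace.exp : A → A) 0 = 1 :=
  hasFDerivAt_exp_zero.fderiv

theorem fderiv_exp_smul_self (u : A) (t : ℝ) :
    fderiv ℝ (NormedSpace.exp : A → A) (t • u) u = NormedSpace.exp (t • u) * u := by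
  have h1 : HasDerivAt (fun s : ℝ => s • u) u t := by
    simpa using (hasDerivAt_id t).smul_const u
  have h2 := (differentiable_exp (t • u)).hasFDerivAt.comp_hasDerivAt t h1
  exact h2.unique (hasDerivAt_exp_smul_const u t)

/-- The second derivative of `exp` at `0` is the symmetrized product: on the diagonal it is the
second derivative of `t ↦ exp (t u)`, and symmetry of second derivatives determines the rest. -/
theorem fderiv_fderiv_exp_zero (u v : A) :
    fderiv ℝ (fderiv ℝ (NormedSpace.exp : A → A)) 0 u v = (1 / 2 : ℝ) • (u * v + v * u) := by
  set S := fderiv ℝ (fderiv ℝ (NormedSpace.exp : A → A)) 0 with hS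
  have hsymm : ∀ a b, S a b = S b a := fun a b =>
    (contDiff_exp.contDiffAt.isSymmSndFDerivAt (by simp)) a b
  have hdiag : ∀ a, S a a = a * a := by
    intro a
    have h1 : HasDerivAt (fun s : ℝ => s • a) a 0 := by
      simpa using (hasDerivAt_id (0 : ℝ)).smul_const a
    have h0 : HasDerivAt (fun s : ℝ => fderiv ℝ (NormedSpace.exp : A → A) (s • a)) (S a) 0 :=
      (differentiable_fderiv_exp (A := A) 0).hasFDerivAt.comp_hasDerivAt_of_eq (0 : ℝ) h1
        (zero_smul ℝ a).symm
    have h2 := h0.clm_apply (hasDerivAt_const (0 : ℝ) a)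
    have h3 : HasDerivAt (fun s : ℝ => NormedSpace.exp (s • a) * a) (a * a) 0 := by
      simpa using (hasDerivAt_exp_smul_const (𝕂 := ℝ) a 0).mul_const a
    have h4 := h2.congr_of_eventuallyEq
      (f₁ := fun s : ℝ => NormedSpace.exp (s • a) * a)
      (Filter.Eventually.of_forall fun s => (fderiv_exp_smul_self a s).symm)
    simpa using h4.unique h3
  have h := hdiag (u + v)
  simp only [map_add, add_apply, hdiag, hsymm v u] at h
  have h' : (2 : ℝ) • S u v = u * v + v * u := by
    rw [two_smul]
    have : u * u + S u v + (S u v + v * v) = u * u + (u * v + v * u) + v * v := by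
      rw [h]; noncomm_ring
    have h5 : (u * u + (S u v + S u v)) + v * v = u * u + (u * v + v * u) + v * v := by
      rw [← this]; abel
    exact add_left_cancel (add_right_cancel h5)
  rw [← h', smul_smul]; norm_num

theorem hasFDerivAt_fderiv_exp_apply (v : A) :
    ∃ F : A →L[ℝ] A, HasFDerivAt (fun x => fderiv ℝ (NormedSpace.exp : A → A) x v) F 0 ∧
      ∀ u, F u = (1 / 2 : ℝ) • (u * v + v * u) := by
  refine ⟨_, (differentiable_fderiv_exp (A := A) 0).hasFDerivAt.clm_apply
    (hasFDerivAt_const v 0), fun u => ?_⟩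
  simp [fderiv_fderiv_exp_zero]

/-- The left Maurer-Cartan form in exponential coordinates is `v - [x, v] / 2` to first order. -/
theorem hasFDerivAt_maurerCartan (v : A) :
    ∃ F : A →L[ℝ] A,
      HasFDerivAt (fun x => NormedSpace.exp (-x) * fderiv ℝ (NormedSpace.exp : A → A) x v) F 0 ∧
      ∀ u, F u = (1 / 2 : ℝ) • (v * u - u * v) := by
  obtain ⟨F, hF, hF'⟩ := hasFDerivAt_fderiv_exp_apply v
  have h1 : HasFDerivAt (fun x : A => NormedSpace.exp (-x)) (-1 : A →L[ℝ] A) 0 := by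
    have h : HasFDerivAt (NormedSpace.exp : A → A) (1 : A →L[ℝ] A) (-0) := by
      rw [neg_zero]; exact hasFDerivAt_exp_zero
    exact (h.comp (0 : A) (hasFDerivAt_id (𝕜 := ℝ) (0 : A)).neg).congr_fderiv (by ext; simp)
  refine ⟨_, h1.mul' hF, fun u => ?_⟩
  simp [fderiv_exp_zero, hF']
  have : u * v = (1 / 2 : ℝ) • (u * v) + (1 / 2 : ℝ) • (u * v) := by
    rw [← add_smul]; norm_num
  nth_rewrite 2 [this]
  simp only [smul_sub]
  norm_num
  abel

variable {d : ℕ} (b : Fin d → A)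

theorem hasFDerivAt_exp_coordSum (x : Fin d → ℝ) :
    ∃ F : (Fin d → ℝ) →L[ℝ] A,
      HasFDerivAt (fun y : Fin d → ℝ => NormedSpace.exp (∑ i, y i • b i)) F x ∧
      ∀ j, F (Pi.single j 1) = fderiv ℝ (NormedSpace.exp : A → A) (∑ i, x i • b i) (b j) := by
  refine ⟨_, (differentiable_exp (∑ i, x i • b i)).hasFDerivAt.comp x
    (hasFDerivAt_coordSum b x), fun j => ?_⟩
  rw [ContinuousLinearMap.comp_apply, coordSum_single]

theorem hasFDerivAt_fderiv_exp_coordSum (k : Fin d) :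
    ∃ F : (Fin d → ℝ) →L[ℝ] A,
      HasFDerivAt (fun y : Fin d → ℝ =>
        fderiv ℝ (NormedSpace.exp : A → A) (∑ i, y i • b i) (b k)) F 0 ∧
      ∀ j, F (Pi.single j 1) = (1 / 2 : ℝ) • (b j * b k + b k * b j) := by
  obtain ⟨F, hF, hF'⟩ := hasFDerivAt_fderiv_exp_apply (b k)
  have hF0 : HasFDerivAt (fun x => fderiv ℝ (NormedSpace.exp : A → A) x (b k)) F
      (∑ i, (0 : Fin d → ℝ) i • b i) := by simpa using hF
  have h := hF0.comp (0 : Fin d → ℝ) (hasFDerivAt_coordSum b 0)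
  refine ⟨_, h, fun j => ?_⟩
  rw [ContinuousLinearMap.comp_apply, coordSum_single, hF']

theorem hasFDerivAt_maurerCartan_coordSum (k : Fin d) :
    ∃ F : (Fin d → ℝ) →L[ℝ] A,
      HasFDerivAt (fun y : Fin d → ℝ => NormedSpace.exp (-∑ i, y i • b i) *
        fderiv ℝ (NormedSpace.exp : A → A) (∑ i, y i • b i) (b k)) F 0 ∧
      ∀ j, F (Pi.single j 1) = (1 / 2 : ℝ) • (b k * b j - b j * b k) := by
  obtain ⟨F, hF, hF'⟩ := hasFDerivAt_maurerCartan (b k)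
  have hF0 : HasFDerivAt (fun x => NormedSpace.exp (-x) *
      fderiv ℝ (NormedSpace.exp : A → A) x (b k)) F
      (∑ i, (0 : Fin d → ℝ) i • b i) := by simpa using hF
  have h := hF0.comp (0 : Fin d → ℝ) (hasFDerivAt_coordSum b 0)
  refine ⟨_, h, fun j => ?_⟩
  rw [ContinuousLinearMap.comp_apply, coordSum_single, hF']

theorem maurerCartan_coordSum_zero (v : A) :
    NormedSpace.exp (-∑ i, (0 : Fin d → ℝ) i • b i) *
      fderiv ℝ (NormedSpace.exp : A → A) (∑ i, (0 : Fin d → ℝ) i • b i) v = v := by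
  simp [fderiv_exp_zero]

end Exponential

/-! ### Derivatives of determinants and inverses -/

section MatrixCalculus

variable {E : Type*} [NormedAddCommGroup E] [NormedSpace ℝ E]

theorem differentiable_det {𝕜 n : Type*} [RCLike 𝕜] [Fintype n] [DecidableEq n] :
    Differentiable ℝ (fun m : n → n → 𝕜 => (Matrix.of m).det) := by
  simp only [Matrix.det_apply, Matrix.of_apply, Units.smul_def]
  fun_prop

/-- Jacobi's formula at the identity matrix. -/
theorem hasFDerivAt_det_of_eq_one {𝕜 n : Type*} [RCLike 𝕜] [Fintype n] [DecidableEq n]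
    {M : E → Matrix n n 𝕜} {M' : n → n → E →L[ℝ] 𝕜} {x : E}
    (hM : ∀ i j, HasFDerivAt (fun y => M y i j) (M' i j) x) (h1 : M x = 1) :
    HasFDerivAt (fun y => (M y).det) (∑ i, M' i i) x := by
  have hM2 : HasFDerivAt (fun y => (fun i j => M y i j : n → n → 𝕜))
      (ContinuousLinearMap.pi fun i => ContinuousLinearMap.pi fun j => M' i j) x :=
    hasFDerivAt_pi.2 fun i => hasFDerivAt_pi.2 fun j => hM i j
  have hd := (differentiable_det (𝕜 := 𝕜) (n := n) (fun i j => M x i j)).hasFDerivAt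
  refine (hd.comp x hM2).congr_fderiv ?_
  ext u
  -- Compare with the derivative along the line `1 + t N`, on which the determinant is a polynomial
  -- `1 + t tr N + O(t²)`.
  set N : n → n → 𝕜 := fun i j => M' i j u with hN
  have hline : HasDerivAt (fun t : ℝ => (fun i j => M x i j + t • N i j : n → n → 𝕜)) N 0 := by
    refine hasDerivAt_pi.2 fun i => hasDerivAt_pi.2 fun j => ?_
    simpa using ((hasDerivAt_id (0 : ℝ)).smul_const (N i j)).const_add (M x i j)
  have h2 := hd.comp_hasDerivAt_of_eq (0 : ℝ) hline (by funext i j; simp)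
  have h3 : HasDerivAt (fun t : ℝ => (Matrix.of (fun i j => M x i j + t • N i j)).det)
      (∑ i, N i i) 0 := by
    obtain ⟨c, hc⟩ : ∃ c : Polynomial 𝕜, ∀ t : ℝ,
        (Matrix.of (fun i j => M x i j + t • N i j)).det
          = 1 + (∑ i, N i i) * (t : 𝕜) + c.eval (t : 𝕜) * (t : 𝕜) ^ 2 := by
      refine ⟨(Matrix.det (1 + (Polynomial.X : Polynomial 𝕜) •
        (Matrix.of N).map Polynomial.C)).divX.divX, fun t => ?_⟩
      have := Matrix.det_one_add_smul (t : 𝕜) (Matrix.of N)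
      rw [Matrix.trace] at this
      simp only [Matrix.diag_apply, Matrix.of_apply] at this
      rw [← this]
      congr 1
      ext i j
      simp [h1, RCLike.real_smul_eq_coe_mul]
    simp only [hc]
    have ht : HasDerivAt (fun t : ℝ => (t : 𝕜)) 1 0 := by
      simpa using (RCLike.ofRealCLM (K := 𝕜)).hasDerivAt (x := (0 : ℝ))
    have hcd : HasDerivAt (fun t : ℝ => c.eval (t : 𝕜))
        ((1 : 𝕜) • c.derivative.eval ((0 : ℝ) : 𝕜)) 0 :=
      (c.hasDerivAt ((0 : ℝ) : 𝕜)).scomp (0 : ℝ) ht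
    exact (((ht.const_mul (∑ i, N i i)).const_add 1).add (hcd.mul (ht.pow 2))).congr_deriv
      (by simp)
  have h4 := h2.unique h3
  simpa [hN] using h4

variable {d : ℕ} {g : E → Matrix (Fin d) (Fin d) ℝ} {g' : Fin d → Fin d → E →L[ℝ] ℝ} {x : E}

/-- Jacobi's formula. -/
theorem hasFDerivAt_det (hg : ∀ i j, HasFDerivAt (fun y => g y i j) (g' i j) x)
    (hx : IsUnit (g x).det) :
    ∃ F : E →L[ℝ] ℝ, HasFDerivAt (fun y => (g y).det) F x ∧
      ∀ u, F u = (g x).det * ((g x)⁻¹ * Matrix.of fun i j => g' i j u).trace := by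
  have h1 : ∀ i j, HasFDerivAt (fun y => ((g x)⁻¹ * g y) i j)
      (∑ k, (g x)⁻¹ i k • g' k j) x := by
    intro i j
    simp only [Matrix.mul_apply]
    exact HasFDerivAt.fun_sum fun k _ => (hg k j).const_mul _
  have h2 := (hasFDerivAt_det_of_eq_one h1 (Matrix.nonsing_inv_mul _ hx)).const_mul (g x).det
  refine ⟨_, h2.congr_of_eventuallyEq (Filter.Eventually.of_forall fun y => ?_), fun u => ?_⟩
  · simp only [← Matrix.det_mul]
    rw [Matrix.mul_nonsing_inv_cancel_left _ _ hx]
  · simp [Matrix.trace, Matrix.mul_apply]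

open scoped Matrix.Norms.Operator in
/-- The derivative of the inverse, in terms of entrywise derivatives: any submultiplicative norm on
matrices serves for the proof. -/
theorem hasFDerivAt_inv_apply (hg : ∀ i j, HasFDerivAt (fun y => g y i j) (g' i j) x)
    (hx : IsUnit (g x).det) (i j : Fin d) :
    ∃ F : E →L[ℝ] ℝ, HasFDerivAt (fun y => (g y)⁻¹ i j) F x ∧
      ∀ u, F u = -((g x)⁻¹ * (Matrix.of fun i j => g' i j u) * (g x)⁻¹) i j := by
  have hsum : HasFDerivAt (fun y => ∑ a, ∑ b, g y a b • Matrix.single a b (1 : ℝ))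
      (∑ a, ∑ b, (g' a b).smulRight (Matrix.single a b (1 : ℝ))) x :=
    HasFDerivAt.fun_sum fun a _ => HasFDerivAt.fun_sum fun b _ => (hg a b).smul_const _
  have hG : HasFDerivAt g (∑ a, ∑ b, (g' a b).smulRight (Matrix.single a b (1 : ℝ))) x := by
    refine hsum.congr_of_eventuallyEq (Filter.Eventually.of_forall fun y => ?_)
    simp only [Matrix.smul_single, smul_eq_mul, mul_one]
    exact Matrix.matrix_eq_sum_single (g y)
  have hinv := (hasFDerivAt_ringInverse (𝕜 := ℝ) (Matrix.nonsingInvUnit (g x) hx)).comp x hG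
  let ev : Matrix (Fin d) (Fin d) ℝ →ₗ[ℝ] ℝ := Matrix.entryLinearMap ℝ ℝ i j
  have hev := ev.toContinuousLinearMap.hasFDerivAt.comp x hinv
  refine ⟨_, hev.congr_of_eventuallyEq (Filter.Eventually.of_forall fun y => ?_), fun u => ?_⟩
  · simp [ev, Matrix.nonsing_inv_eq_ringInverse]
  · have : (Matrix.of fun i j => g' i j u) = ∑ a, ∑ b, g' a b u • Matrix.single a b (1 : ℝ) := by
      simp only [Matrix.smul_single, smul_eq_mul, mul_one]
      exact Matrix.matrix_eq_sum_single _
    rw [this]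
    change -((g x)⁻¹ * ((∑ a, ∑ b, (g' a b).smulRight (Matrix.single a b (1 : ℝ))) u)
      * (g x)⁻¹) i j = _
    simp

end MatrixCalculus

/-! ### The tension field at a point with harmonic coordinates -/

/-- If the metric determinant is critical at `0` and `∑ⱼₐ gʲᵃ ∂ⱼ g_{ab} = 0` there (so that the
coordinates are harmonic at `0`), the Laplace-Beltrami operator at `0` reduces to its
second-order part. -/
theorem coordTension_zero_eq {d : ℕ} {g : (Fin d → ℝ) → Matrix (Fin d) (Fin d) ℝ}
    {f : (Fin d → ℝ) → ℂ} {g' : Fin d → Fin d → (Fin d → ℝ) →L[ℝ] ℝ}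
    {f' : Fin d → (Fin d → ℝ) →L[ℝ] ℂ}
    (hg : ∀ a b, HasFDerivAt (fun y => g y a b) (g' a b) 0)
    (hf : ∀ k, HasFDerivAt (pderiv k f) (f' k) 0)
    (hpos : 0 < (g 0).det)
    (hdet : ∀ j, ((g 0)⁻¹ * Matrix.of fun a b => g' a b (Pi.single j 1)).trace = 0)
    (hdiv : ∀ b, ∑ j, ∑ a, (g 0)⁻¹ j a * g' a b (Pi.single j 1) = 0) :
    coordTension g f 0 = ∑ j, ∑ k, (((g 0)⁻¹ j k : ℝ) : ℂ) * f' k (Pi.single j 1) := by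
  have hu : IsUnit (g 0).det := hpos.ne'.isUnit
  obtain ⟨F, hF, hF'⟩ := hasFDerivAt_det hg hu
  choose H hH hH' using fun i j => hasFDerivAt_inv_apply hg hu i j
  have hsq : HasFDerivAt (fun y => ((√(g y).det : ℝ) : ℂ)) _ 0 :=
    Complex.ofRealCLM.hasFDerivAt.comp (0 : Fin d → ℝ) (hF.sqrt hpos.ne')
  have hi : ∀ j k, HasFDerivAt (fun y => (((g y)⁻¹ j k : ℝ) : ℂ)) _ 0 := fun j k =>
    Complex.ofRealCLM.hasFDerivAt.comp (0 : Fin d → ℝ) (hH j k)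
  have key : ∀ j, pderiv j (fun y => ((√(g y).det : ℝ) : ℂ) * coordGradient g f y j) 0
      = ((√(g 0).det : ℝ) : ℂ) * ∑ k, ((((g 0)⁻¹ j k : ℝ) : ℂ) * f' k (Pi.single j 1)
        + pderiv k f 0 * ((H j k (Pi.single j 1) : ℝ) : ℂ)) := by
    intro j
    have hgrad : HasFDerivAt (fun y => coordGradient g f y j) _ 0 :=
      HasFDerivAt.fun_sum fun k _ => (hi j k).mul (hf k)
    rw [pderiv, (hsq.fun_mul hgrad).fderiv]
    have h0 : F (Pi.single j 1) = 0 := by rw [hF', hdet, mul_zero]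
    simp [h0]
  -- The divergence of the inverse metric vanishes along with that of the metric.
  have hz : ∀ k, ∑ j, H j k (Pi.single j 1) = 0 := by
    intro k
    have : ∀ j, H j k (Pi.single j 1)
        = -∑ b, (∑ a, (g 0)⁻¹ j a * g' a b (Pi.single j 1)) * (g 0)⁻¹ b k := by
      intro j
      rw [hH', Matrix.mul_apply]
      simp [Matrix.mul_apply]
    simp only [this, Finset.sum_neg_distrib]
    rw [Finset.sum_comm]
    simp only [← Finset.sum_mul, hdiv]
    simp
  have hs : ((√(g 0).det : ℝ) : ℂ) ≠ 0 := by
    exact_mod_cast (Real.sqrt_pos.2 hpos).ne'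
  rw [coordTension]
  simp only [key, ← Finset.mul_sum, Finset.sum_add_distrib]
  rw [← mul_assoc]
  have : ∑ j, ∑ k, pderiv k f 0 * ((H j k (Pi.single j 1) : ℝ) : ℂ) = 0 := by
    rw [Finset.sum_comm]
    refine Finset.sum_eq_zero fun k _ => ?_
    rw [← Finset.mul_sum, ← Complex.ofReal_sum, hz]
    simp
  rw [this, add_zero]
  push_cast
  rw [one_div, inv_mul_cancel₀ hs, one_mul]

/-- The conformality operator in terms of partial derivatives and the inverse metric. -/
theorem coordConformality_eq {d : ℕ} {g : (Fin d → ℝ) → Matrix (Fin d) (Fin d) ℝ}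
    {f h : (Fin d → ℝ) → ℂ} {x : Fin d → ℝ} (hu : IsUnit (g x).det) (hs : (g x)ᵀ = g x) :
    coordConformality g f h x
      = ∑ j, ∑ k, (((g x)⁻¹ j k : ℝ) : ℂ) * (pderiv j f x * pderiv k h x) := by
  have h1 : ∀ j, ∑ i, ((g x i j : ℝ) : ℂ) * coordGradient g f x i = pderiv j f x := by
    intro j
    simp only [coordGradient, Finset.mul_sum]
    rw [Finset.sum_comm]
    have : ∀ k, ∑ i, ((g x i j : ℝ) : ℂ) * ((((g x)⁻¹ i k : ℝ) : ℂ) * pderiv k f x)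
        = ((((g x) * (g x)⁻¹) j k : ℝ) : ℂ) * pderiv k f x := by
      intro k
      rw [Matrix.mul_apply]
      push_cast
      rw [Finset.sum_mul]
      refine Finset.sum_congr rfl fun i _ => ?_
      have : g x j i = g x i j := congrFun (congrFun hs i) j
      rw [this]; ring
    refine (Finset.sum_congr rfl fun k _ => this k).trans ?_
    rw [Matrix.mul_nonsing_inv _ hu]
    refine (Finset.sum_eq_single j (fun k _ hk => ?_) (by simp)).trans ?_
    · rw [Matrix.one_apply_ne hk.symm]; simp
    · rw [Matrix.one_apply_eq]; simp
  rw [coordConformality, Finset.sum_comm]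
  simp only [← Finset.sum_mul, h1]
  simp only [coordGradient, Finset.mul_sum]
  exact Finset.sum_congr rfl fun j _ => Finset.sum_congr rfl fun k _ => by ring

/-! ### The inner product on matrices -/

section InnerForm

variable {𝕜 ι : Type*} [RCLike 𝕜] [Fintype ι]

/-- `innerForm` as a real bilinear map. -/
def innerBilin (𝕜 ι : Type*) [RCLike 𝕜] [Fintype ι] :
    Matrix ι ι 𝕜 →ₗ[ℝ] Matrix ι ι 𝕜 →ₗ[ℝ] ℝ :=
  LinearMap.mk₂ ℝ innerForm
    (fun X Y Z => by simp [innerForm, add_mul, Matrix.trace_add])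
    (fun c X Y => by simp [innerForm, Matrix.trace_smul, RCLike.smul_re])
    (fun X Y Z => by simp [innerForm, mul_add, Matrix.trace_add])
    (fun c X Y => by simp [innerForm, Matrix.conjTranspose_smul, Matrix.trace_smul, RCLike.smul_re])

theorem innerBilin_apply (X Y : Matrix ι ι 𝕜) : innerBilin 𝕜 ι X Y = innerForm X Y := rfl

theorem innerForm_comm (X Y : Matrix ι ι 𝕜) : innerForm X Y = innerForm Y X := by
  rw [innerForm, innerForm, ← RCLike.conj_re, starRingEnd_apply, ← Matrix.trace_conjTranspose,
    Matrix.conjTranspose_mul, Matrix.conjTranspose_conjTranspose]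

theorem innerForm_apply (X Y : Matrix ι ι 𝕜) :
    innerForm X Y = ∑ r, ∑ s, (RCLike.re (X r s) * RCLike.re (Y r s)
      + RCLike.im (X r s) * RCLike.im (Y r s)) := by
  simp [innerForm, Matrix.trace, Matrix.mul_apply]

theorem innerForm_self_pos {X : Matrix ι ι 𝕜} (hX : X ≠ 0) : 0 < innerForm X X := by
  rw [innerForm_apply]
  obtain ⟨r, s, h⟩ : ∃ r s, X r s ≠ 0 := by
    by_contra! h
    exact hX (Matrix.ext h)
  have hnn : ∀ r s, 0 ≤ RCLike.re (X r s) * RCLike.re (X r s)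
      + RCLike.im (X r s) * RCLike.im (X r s) := fun r s =>
    add_nonneg (mul_self_nonneg _) (mul_self_nonneg _)
  refine Finset.sum_pos' (fun r _ => Finset.sum_nonneg fun s _ => hnn r s)
    ⟨r, Finset.mem_univ _, Finset.sum_pos' (fun s _ => hnn r s) ⟨s, Finset.mem_univ _, ?_⟩⟩
  rw [← RCLike.normSq_apply]
  exact (RCLike.normSq_nonneg _).lt_of_ne' (by simpa [RCLike.normSq_eq_zero] using h)

end InnerForm

/-! ### Derivatives in exponential coordinates -/

section Chart

variable {𝕜 ι : Type*} [RCLike 𝕜] [Fintype ι] [DecidableEq ι]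

open scoped Matrix.Norms.Operator

theorem pderiv_linear_exp {K : Type*} [RCLike K] {d : ℕ} (b : Fin d → Matrix ι ι 𝕜)
    (L : Matrix ι ι 𝕜 →ₗ[ℝ] K) (p : Matrix ι ι 𝕜) (x : Fin d → ℝ) (i : Fin d) :
    pderiv i (fun y => L (p * NormedSpace.exp (∑ i, y i • b i))) x
      = L (p * fderiv ℝ (NormedSpace.exp : Matrix ι ι 𝕜 → _) (∑ i, x i • b i) (b i)) := by
  obtain ⟨F, hF, hF'⟩ := hasFDerivAt_exp_coordSum b x
  have h : HasFDerivAt (fun y : Fin d → ℝ => L (p * NormedSpace.exp (∑ i, y i • b i))) _ x :=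
    L.toContinuousLinearMap.hasFDerivAt.comp x (hF.const_mul p)
  rw [pderiv, h.fderiv]
  exact congrArg (fun Y => L (p * Y)) (hF' i)

theorem pderiv_linear_exp_zero {K : Type*} [RCLike K] {d : ℕ} (b : Fin d → Matrix ι ι 𝕜)
    (L : Matrix ι ι 𝕜 →ₗ[ℝ] K) (p : Matrix ι ι 𝕜) (i : Fin d) :
    pderiv i (fun y => L (p * NormedSpace.exp (∑ i, y i • b i))) 0 = L (p * b i) := by
  rw [pderiv_linear_exp]
  have h : fderiv ℝ (NormedSpace.exp : Matrix ι ι 𝕜 → _) (∑ i, (0 : Fin d → ℝ) i • b i) (b i)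
      = b i := by
    have h0 : ∑ i, (0 : Fin d → ℝ) i • b i = 0 := by simp
    rw [h0]
    exact congrArg (fun T : Matrix ι ι 𝕜 →L[ℝ] Matrix ι ι 𝕜 => T (b i)) fderiv_exp_zero
  rw [h]

theorem hasFDerivAt_pderiv_linear_exp {d : ℕ} (b : Fin d → Matrix ι ι 𝕜)
    (L : Matrix ι ι 𝕜 →ₗ[ℝ] ℂ) (p : Matrix ι ι 𝕜) (k : Fin d) :
    ∃ F : (Fin d → ℝ) →L[ℝ] ℂ,
      HasFDerivAt (pderiv k (fun y => L (p * NormedSpace.exp (∑ i, y i • b i)))) F 0 ∧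
      ∀ j, F (Pi.single j 1) = L (p * ((1 / 2 : ℝ) • (b j * b k + b k * b j))) := by
  obtain ⟨F, hF, hF'⟩ := hasFDerivAt_fderiv_exp_coordSum b k
  have h := L.toContinuousLinearMap.hasFDerivAt.comp (0 : Fin d → ℝ) (hF.const_mul p)
  refine ⟨_, h.congr_of_eventuallyEq (Filter.Eventually.of_forall fun y => ?_), fun j => ?_⟩
  · exact pderiv_linear_exp b L p y k
  · exact congrArg (fun Y => L (p * Y)) (hF' j)

/-- The first derivatives at `0` of the metric coefficients in exponential coordinates; see
`metricCoeff_eq`. -/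
theorem hasFDerivAt_innerForm_maurerCartan {d : ℕ} (b : Fin d → Matrix ι ι 𝕜) (i j : Fin d) :
    ∃ F : (Fin d → ℝ) →L[ℝ] ℝ,
      HasFDerivAt (fun x : Fin d → ℝ => innerForm
        (NormedSpace.exp (-∑ i, x i • b i)
          * fderiv ℝ (NormedSpace.exp : Matrix ι ι 𝕜 → _) (∑ i, x i • b i) (b i))
        (NormedSpace.exp (-∑ i, x i • b i)
          * fderiv ℝ (NormedSpace.exp : Matrix ι ι 𝕜 → _) (∑ i, x i • b i) (b j))) F 0 ∧
      ∀ k, F (Pi.single k 1) = 1 / 2 * (innerForm (b i * b k - b k * b i) (b j)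
        + innerForm (b j * b k - b k * b j) (b i)) := by
  obtain ⟨F, hF, hF'⟩ := hasFDerivAt_maurerCartan_coordSum b i
  obtain ⟨H, hH, hH'⟩ := hasFDerivAt_maurerCartan_coordSum b j
  refine ⟨_, (innerBilin 𝕜 ι).toContinuousBilinearMap.hasFDerivAt_of_bilinear hF hH, fun k => ?_⟩
  refine (congrArg₂ (fun X Y => innerBilin 𝕜 ι X (H (Pi.single k 1))
    + innerBilin 𝕜 ι (F (Pi.single k 1)) Y) (maurerCartan_coordSum_zero b (b i))
    (maurerCartan_coordSum_zero b (b j))).trans ?_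
  rw [hF', hH', map_smul, map_smul, LinearMap.smul_apply, innerBilin_apply, innerBilin_apply,
    innerForm_comm (b i)]
  simp only [smul_eq_mul]
  ring

theorem coordVector_eq (G : Set (Matrix ι ι 𝕜)) (p : Matrix ι ι 𝕜)
    (x : Fin (Module.finrank ℝ (lieAlgebra G)) → ℝ) (i : Fin (Module.finrank ℝ (lieAlgebra G))) :
    coordVector G p x i = p * fderiv ℝ (NormedSpace.exp : Matrix ι ι 𝕜 → _)
      (∑ i, x i • (Module.finBasis ℝ (lieAlgebra G) i : Matrix ι ι 𝕜))
      (Module.finBasis ℝ (lieAlgebra G) i : Matrix ι ι 𝕜) := by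
  ext r s
  exact pderiv_linear_exp (fun i => (Module.finBasis ℝ (lieAlgebra G) i : Matrix ι ι 𝕜))
    (Matrix.entryLinearMap ℝ 𝕜 r s) p x i

/-- The metric is the pullback of `innerForm` by the left Maurer-Cartan form. -/
theorem metricCoeff_eq (G : Set (Matrix ι ι 𝕜)) {p : Matrix ι ι 𝕜} (hp : IsUnit p.det)
    (x : Fin (Module.finrank ℝ (lieAlgebra G)) → ℝ)
    (i j : Fin (Module.finrank ℝ (lieAlgebra G))) :
    metricCoeff G p x i j = innerForm
      (NormedSpace.exp (-∑ i, x i • (Module.finBasis ℝ (lieAlgebra G) i : Matrix ι ι 𝕜))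
        * fderiv ℝ (NormedSpace.exp : Matrix ι ι 𝕜 → _)
          (∑ i, x i • (Module.finBasis ℝ (lieAlgebra G) i : Matrix ι ι 𝕜))
          (Module.finBasis ℝ (lieAlgebra G) i : Matrix ι ι 𝕜))
      (NormedSpace.exp (-∑ i, x i • (Module.finBasis ℝ (lieAlgebra G) i : Matrix ι ι 𝕜))
        * fderiv ℝ (NormedSpace.exp : Matrix ι ι 𝕜 → _)
          (∑ i, x i • (Module.finBasis ℝ (lieAlgebra G) i : Matrix ι ι 𝕜))
          (Module.finBasis ℝ (lieAlgebra G) j : Matrix ι ι 𝕜)) := by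
  have h : ∀ Y, (expChart G p x)⁻¹ * (p * Y)
      = NormedSpace.exp (-∑ i, x i • (Module.finBasis ℝ (lieAlgebra G) i : Matrix ι ι 𝕜)) * Y := by
    intro Y
    rw [expChart, Matrix.mul_inv_rev, ← Matrix.exp_neg, mul_assoc,
      Matrix.nonsing_inv_mul_cancel_left _ _ hp]
  rw [metricCoeff, Matrix.of_apply, leftInvariantMetric, coordVector_eq, coordVector_eq, h, h]

theorem metricCoeff_zero {G : Set (Matrix ι ι 𝕜)} {p : Matrix ι ι 𝕜} (hp : IsUnit p.det) :
    metricCoeff G p 0 = Matrix.of fun i j =>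
      innerForm (Module.finBasis ℝ (lieAlgebra G) i : Matrix ι ι 𝕜)
        (Module.finBasis ℝ (lieAlgebra G) j) := by
  ext i j
  rw [metricCoeff_eq G hp]
  exact congrArg₂ innerForm
    (maurerCartan_coordSum_zero (fun i => (Module.finBasis ℝ (lieAlgebra G) i : Matrix ι ι 𝕜)) _)
    (maurerCartan_coordSum_zero (fun i => (Module.finBasis ℝ (lieAlgebra G) i : Matrix ι ι 𝕜)) _)

end Chart

/-! ### Sums over a basis and orthogonal projections -/

section Frame

variable {𝕜 ι : Type*} [RCLike 𝕜] [Fintype ι]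
  {W : Type*} [AddCommGroup W] [Module ℝ W]

/-- The trace of a real bilinear map `β` over the subspace with basis `b`, taken with respect to
`innerForm`: the coefficients are those of the inverse Gram matrix. -/
def gramSum {d : ℕ} (b : Fin d → Matrix ι ι 𝕜)
    (β : Matrix ι ι 𝕜 →ₗ[ℝ] Matrix ι ι 𝕜 →ₗ[ℝ] W) : W :=
  ∑ j, ∑ k, (Matrix.of fun i j => innerForm (b i) (b j))⁻¹ j k • β (b j) (b k)

variable {d : ℕ} {g : Submodule ℝ (Matrix ι ι 𝕜)} (b : Module.Basis (Fin d) ℝ g)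

theorem gram_posDef :
    (Matrix.of fun i j => innerForm (b i : Matrix ι ι 𝕜) (b j)).PosDef := by
  rw [Matrix.posDef_iff_dotProduct_mulVec]
  refine ⟨by ext i j; simp [innerForm_comm], fun {x} hx => ?_⟩
  have h1 : star x ⬝ᵥ (Matrix.of fun i j => innerForm (b i : Matrix ι ι 𝕜) (b j)) *ᵥ x
      = innerForm ((∑ i, x i • b i : g) : Matrix ι ι 𝕜) ((∑ i, x i • b i : g) : Matrix ι ι 𝕜) := by
    rw [← innerBilin_apply]
    simp [dotProduct, Matrix.mulVec, Finset.mul_sum, innerBilin_apply]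
    refine Finset.sum_congr rfl fun i _ => Finset.sum_congr rfl fun j _ => ?_
    rw [innerForm_comm (b j : Matrix ι ι 𝕜)]
    ring
  rw [h1]
  refine innerForm_self_pos fun h0 => hx ?_
  have h2 : ∑ i, x i • b i = 0 := Subtype.ext h0
  funext i
  exact Fintype.linearIndependent_iff.1 b.linearIndependent x h2 i

theorem gram_inv_symm (j k : Fin d) :
    (Matrix.of fun i j => innerForm (b i : Matrix ι ι 𝕜) (b j))⁻¹ j k
      = (Matrix.of fun i j => innerForm (b i : Matrix ι ι 𝕜) (b j))⁻¹ k j := by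
  have h : (Matrix.of fun i j => innerForm (b i : Matrix ι ι 𝕜) (b j))ᵀ
      = Matrix.of fun i j => innerForm (b i : Matrix ι ι 𝕜) (b j) := by
    ext i j; simp [innerForm_comm]
  conv_lhs => rw [← h, ← Matrix.transpose_nonsing_inv]
  rfl

theorem gramSum_flip (β : Matrix ι ι 𝕜 →ₗ[ℝ] Matrix ι ι 𝕜 →ₗ[ℝ] W) :
    gramSum (fun i => (b i : Matrix ι ι 𝕜)) β.flip = gramSum (fun i => (b i : Matrix ι ι 𝕜)) β := by
  rw [gramSum, gramSum, Finset.sum_comm]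
  refine Finset.sum_congr rfl fun j _ => Finset.sum_congr rfl fun k _ => ?_
  rw [gram_inv_symm, LinearMap.flip_apply]

variable {b} in
/-- Expansion of an element of the subspace in the dual basis. -/
theorem sum_gram_inv_smul {X : Matrix ι ι 𝕜} (hX : X ∈ g) :
    ∑ j, ∑ k, ((Matrix.of fun i j => innerForm (b i : Matrix ι ι 𝕜) (b j))⁻¹ j k
      * innerForm (b k : Matrix ι ι 𝕜) X) • (b j : Matrix ι ι 𝕜) = X := by
  set Gm := Matrix.of fun i j => innerForm (b i : Matrix ι ι 𝕜) (b j) with hGm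
  set c := b.repr ⟨X, hX⟩ with hc
  have hXc : X = ∑ i, c i • (b i : Matrix ι ι 𝕜) := by
    have := congrArg g.subtype (b.sum_repr ⟨X, hX⟩).symm
    simpa only [map_sum, map_smul, Submodule.subtype_apply] using this
  have h1 : ∀ k, innerForm (b k : Matrix ι ι 𝕜) X = (Gm *ᵥ c) k := by
    intro k
    conv_lhs => rw [hXc]
    rw [← innerBilin_apply]
    simp [Matrix.mulVec, dotProduct, hGm, innerBilin_apply, mul_comm]
  have h2 : ∀ j, ∑ k, Gm⁻¹ j k * (Gm *ᵥ c) k = c j := by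
    intro j
    have : (Gm⁻¹ *ᵥ (Gm *ᵥ c)) j = c j := by
      rw [Matrix.mulVec_mulVec, Matrix.nonsing_inv_mul _ (gram_posDef b).det_pos.ne'.isUnit,
        Matrix.one_mulVec]
    exact this
  simp only [← Finset.sum_smul, h1, h2]
  exact hXc.symm

variable [DecidableEq ι]

/-- The sum `∑ β(PY, Y)` over the orthonormal basis of all matrices that consists of the matrix
units and, if `𝕜 = ℂ`, of their multiples by `i`. (For `𝕜 = ℝ` one has `RCLike.I = 0`, and the
second summand vanishes.) -/
def frameSum (P : Matrix ι ι 𝕜 → Matrix ι ι 𝕜) (β : Matrix ι ι 𝕜 → Matrix ι ι 𝕜 → W) : W :=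
  ∑ r, ∑ s, (β (P (Matrix.single r s 1)) (Matrix.single r s 1)
    + β (P (Matrix.single r s RCLike.I)) (Matrix.single r s RCLike.I))

theorem innerForm_single (X : Matrix ι ι 𝕜) (r s : ι) (c : 𝕜) :
    innerForm X (Matrix.single r s c)
      = RCLike.re (X r s) * RCLike.re c + RCLike.im (X r s) * RCLike.im c := by
  rw [innerForm_apply, Finset.sum_eq_single r, Finset.sum_eq_single s]
  · simp
  · intro b _ hb; simp [hb.symm]
  · simp
  · intro b _ hb; simp [hb.symm]
  · simp

theorem sum_innerForm_single (X : Matrix ι ι 𝕜) :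
    ∑ r, ∑ s, (innerForm X (Matrix.single r s 1) • (Matrix.single r s 1 : Matrix ι ι 𝕜)
      + innerForm X (Matrix.single r s RCLike.I) • Matrix.single r s RCLike.I) = X := by
  conv_rhs => rw [Matrix.matrix_eq_sum_single X]
  refine Finset.sum_congr rfl fun r _ => Finset.sum_congr rfl fun s _ => ?_
  rw [innerForm_single, innerForm_single, Matrix.smul_single, Matrix.smul_single,
    ← Matrix.single_add]
  congr 1
  have h : (RCLike.im (X r s) * RCLike.im (RCLike.I : 𝕜) : ℝ) • (RCLike.I : 𝕜)
      = (RCLike.im (X r s) : 𝕜) * RCLike.I := by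
    rw [RCLike.mul_im_I_ax, RCLike.real_smul_eq_coe_mul]
  simp only [RCLike.one_re, RCLike.one_im, RCLike.I_re, mul_one, mul_zero, add_zero, zero_add]
  rw [h, RCLike.real_smul_eq_coe_mul, mul_one, RCLike.re_add_im]

/-- If `P` is the orthogonal projection onto a subspace, the trace of `β` over the subspace is
`∑ β(PY, Y)` over an orthonormal basis of the whole space. -/
theorem gramSum_eq_frameSum {P : Matrix ι ι 𝕜 →ₗ[ℝ] Matrix ι ι 𝕜} (hmem : ∀ Y, P Y ∈ g)
    (hfix : ∀ X ∈ g, P X = X) (hsymm : ∀ Y Z, innerForm (P Y) Z = innerForm Y (P Z))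
    (β : Matrix ι ι 𝕜 →ₗ[ℝ] Matrix ι ι 𝕜 →ₗ[ℝ] W) :
    gramSum (fun i => (b i : Matrix ι ι 𝕜)) β = frameSum P (fun X Y => β X Y) := by
  set Gi := (Matrix.of fun i j => innerForm (b i : Matrix ι ι 𝕜) (b j))⁻¹ with hGi
  have h1 : ∀ Y, P Y = ∑ j, ∑ k, (Gi j k * innerForm (b k : Matrix ι ι 𝕜) Y)
      • (b j : Matrix ι ι 𝕜) := by
    intro Y
    rw [← sum_gram_inv_smul (b := b) (hmem Y)]
    refine Finset.sum_congr rfl fun j _ => Finset.sum_congr rfl fun k _ => ?_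
    rw [← hsymm, hfix _ (b k).2]
  have h2 : ∀ Y Z, β (P Y) Z = ∑ j, ∑ k, Gi j k •
      β (b j) (innerForm (b k : Matrix ι ι 𝕜) Y • Z) := by
    intro Y Z
    rw [h1 Y]
    simp [mul_smul]
  have h3 : ∀ k, (b k : Matrix ι ι 𝕜) = _ := fun k => (sum_innerForm_single (b k : Matrix ι ι 𝕜)).symm
  simp only [frameSum, h2, gramSum, ← hGi]
  have h4 : ∀ j k, β (b j) (b k) = ∑ r, ∑ s,
      (β (b j) (innerForm (b k : Matrix ι ι 𝕜) (Matrix.single r s 1) • Matrix.single r s 1)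
        + β (b j) (innerForm (b k : Matrix ι ι 𝕜) (Matrix.single r s RCLike.I)
          • Matrix.single r s RCLike.I)) := by
    intro j k
    conv_lhs => rw [h3 k]
    simp only [map_sum, map_add]
  simp only [h4, Finset.smul_sum, smul_add]
  simp only [← Finset.sum_add_distrib]
  rw [Finset.sum_congr rfl fun j _ => Finset.sum_comm]
  rw [Finset.sum_comm]
  refine Finset.sum_congr rfl fun r _ => ?_
  rw [Finset.sum_congr rfl fun j _ => Finset.sum_comm]
  rw [Finset.sum_comm]

end Frame

/-! ### Tension field and conformality operator on a matrix group -/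

section MatrixGroup

variable {𝕜 ι : Type*} [RCLike 𝕜] [Fintype ι] [DecidableEq ι]

/-- Conjugate transposition maps the orthonormal basis in `frameSum` to itself up to signs. -/
theorem frameSum_conjTranspose {W : Type*} [AddCommGroup W] [Module ℝ W]
    (P : Matrix ι ι 𝕜 →ₗ[ℝ] Matrix ι ι 𝕜) (β : Matrix ι ι 𝕜 →ₗ[ℝ] Matrix ι ι 𝕜 →ₗ[ℝ] W) :
    frameSum P (fun X Y => β X Y) = ∑ r, ∑ s,
      (β (P (Matrix.single r s (1 : 𝕜))ᴴ) (Matrix.single r s (1 : 𝕜))ᴴ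
        + β (P (Matrix.single r s (RCLike.I : 𝕜))ᴴ) (Matrix.single r s (RCLike.I : 𝕜))ᴴ) := by
  rw [frameSum, Finset.sum_comm]
  refine Finset.sum_congr rfl fun s _ => Finset.sum_congr rfl fun r _ => ?_
  have h : (Matrix.single s r (RCLike.I : 𝕜))ᴴ = -Matrix.single r s RCLike.I := by
    rw [Matrix.conjTranspose_single, RCLike.star_def, RCLike.conj_I, Matrix.single_neg]
  rw [h, Matrix.conjTranspose_single, star_one]
  simp only [map_neg, LinearMap.neg_apply, neg_neg]

/-- A Lie algebra of matrices that is stable under conjugate transposition is unimodular: the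
bracket with any matrix has trace zero on it. -/
theorem sum_gram_inv_mul_innerForm_comm {d : ℕ} {g : Submodule ℝ (Matrix ι ι 𝕜)}
    (b : Module.Basis (Fin d) ℝ g) {P : Matrix ι ι 𝕜 →ₗ[ℝ] Matrix ι ι 𝕜} (hmem : ∀ Y, P Y ∈ g)
    (hfix : ∀ X ∈ g, P X = X) (hsymm : ∀ Y Z, innerForm (P Y) Z = innerForm Y (P Z))
    (hstar : ∀ Y, P Yᴴ = (P Y)ᴴ) (Z : Matrix ι ι 𝕜) :
    ∑ j, ∑ k, (Matrix.of fun i j => innerForm (b i : Matrix ι ι 𝕜) (b j))⁻¹ j k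
      * innerForm ((b j : Matrix ι ι 𝕜) * Z - Z * (b j : Matrix ι ι 𝕜)) (b k : Matrix ι ι 𝕜) = 0 := by
  let β₁ := (innerBilin 𝕜 ι).comp (LinearMap.mulRight ℝ Z)
  let β₂ := (innerBilin 𝕜 ι).comp (LinearMap.mulLeft ℝ Z)
  have h : gramSum (fun i => (b i : Matrix ι ι 𝕜)) (β₁ - β₂) = 0 := by
    have e : gramSum (fun i => (b i : Matrix ι ι 𝕜)) (β₁ - β₂)
        = gramSum (fun i => (b i : Matrix ι ι 𝕜)) β₁
          - gramSum (fun i => (b i : Matrix ι ι 𝕜)) β₂ := by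
      simp [gramSum, mul_sub]
    rw [e, sub_eq_zero, ← gramSum_flip, gramSum_eq_frameSum b hmem hfix hsymm,
      gramSum_eq_frameSum b hmem hfix hsymm, frameSum_conjTranspose P β₂]
    -- `⟨Y Z, P Y⟩ = ⟨Z (P Y)*, Y*⟩`, and `P` commutes with conjugate transposition.
    have key : ∀ Y, β₁ Y (P Y) = β₂ (P Yᴴ) Yᴴ := by
      intro Y
      simp only [β₁, β₂, LinearMap.comp_apply, LinearMap.mulRight_apply, LinearMap.mulLeft_apply,
        innerBilin_apply, innerForm, hstar, Matrix.conjTranspose_conjTranspose]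
      rw [mul_assoc, Matrix.trace_mul_comm]
    exact Finset.sum_congr rfl fun r _ => Finset.sum_congr rfl fun s _ => by
      simp only [LinearMap.flip_apply, key]
  refine Eq.trans ?_ h
  simp only [gramSum, β₁, β₂, LinearMap.sub_apply, LinearMap.comp_apply, innerBilin_apply,
    LinearMap.mulRight_apply, LinearMap.mulLeft_apply, smul_eq_mul]
  refine Finset.sum_congr rfl fun j _ => Finset.sum_congr rfl fun k _ => ?_
  rw [← innerBilin_apply, map_sub, LinearMap.sub_apply]
  rfl

variable {G : Set (Matrix ι ι 𝕜)} {p : Matrix ι ι 𝕜}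

/-- The conformality operator of a linear function is the trace of `(X, Y) ↦ L(pX) L(pY)` over the
Lie algebra. -/
theorem conformality_eq_gramSum (hp : IsUnit p.det) (L : Matrix ι ι 𝕜 →ₗ[ℝ] ℂ) :
    conformality G L L p
      = gramSum (fun i => (Module.finBasis ℝ (lieAlgebra G) i : Matrix ι ι 𝕜))
        ((LinearMap.mul ℝ ℂ).compl₁₂ (L ∘ₗ LinearMap.mulLeft ℝ p)
          (L ∘ₗ LinearMap.mulLeft ℝ p)) := by
  have h0 := metricCoeff_zero (G := G) hp
  have hpd := gram_posDef (Module.finBasis ℝ (lieAlgebra G))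
  have h1 : ∀ j, pderiv j (fun x => L (expChart G p x)) 0
      = L (p * (Module.finBasis ℝ (lieAlgebra G) j : Matrix ι ι 𝕜)) := by
    intro j
    exact pderiv_linear_exp_zero (fun i => (Module.finBasis ℝ (lieAlgebra G) i : Matrix ι ι 𝕜))
      L p j
  rw [conformality, coordConformality_eq (by rw [h0]; exact hpd.det_pos.ne'.isUnit)
    (by rw [h0]; ext i j; simp [innerForm_comm]), h0]
  simp only [h1, gramSum, LinearMap.compl₁₂_apply, LinearMap.comp_apply, LinearMap.mulLeft_apply,
    LinearMap.mul_apply', Complex.real_smul]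

/-- The tension field of a linear function is the trace of `(X, Y) ↦ L(pXY)` over the Lie algebra. -/
theorem tension_eq_gramSum (hp : IsUnit p.det) {P : Matrix ι ι 𝕜 →ₗ[ℝ] Matrix ι ι 𝕜}
    (hmem : ∀ Y, P Y ∈ lieAlgebra G) (hfix : ∀ X ∈ lieAlgebra G, P X = X)
    (hsymm : ∀ Y Z, innerForm (P Y) Z = innerForm Y (P Z)) (hstar : ∀ Y, P Yᴴ = (P Y)ᴴ)
    (L : Matrix ι ι 𝕜 →ₗ[ℝ] ℂ) :
    tension G L p
      = gramSum (fun i => (Module.finBasis ℝ (lieAlgebra G) i : Matrix ι ι 𝕜))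
        ((LinearMap.mul ℝ (Matrix ι ι 𝕜)).compr₂ (L ∘ₗ LinearMap.mulLeft ℝ p)) := by
  set b : Fin (Module.finrank ℝ (lieAlgebra G)) → Matrix ι ι 𝕜 :=
    fun i => (Module.finBasis ℝ (lieAlgebra G) i : Matrix ι ι 𝕜) with hb
  have h0 := metricCoeff_zero (G := G) hp
  have hpd := gram_posDef (Module.finBasis ℝ (lieAlgebra G))
  have hsy := gram_inv_symm (Module.finBasis ℝ (lieAlgebra G))
  have huni := sum_gram_inv_mul_innerForm_comm (Module.finBasis ℝ (lieAlgebra G)) hmem hfix hsymm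
    hstar
  rw [← h0] at hpd huni
  simp only [← h0] at hsy
  set Gi := (metricCoeff G p 0)⁻¹ with hGi
  choose g' hg' hg'2 using fun i j => hasFDerivAt_innerForm_maurerCartan b i j
  choose f' hf' hf'2 using fun k => hasFDerivAt_pderiv_linear_exp b L p k
  have hg : ∀ i j, HasFDerivAt (fun x => metricCoeff G p x i j) (g' i j) 0 := fun i j =>
    (hg' i j).congr_of_eventuallyEq
      (Filter.Eventually.of_forall fun x => metricCoeff_eq G hp x i j)
  have hdet : ∀ j, (Gi * Matrix.of fun a c => g' a c (Pi.single j 1)).trace = 0 := by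
    intro j
    have e : (Gi * Matrix.of fun a c => g' a c (Pi.single j 1)).trace
        = ∑ a, ∑ c, Gi a c * innerForm (b a * b j - b j * b a) (b c) := by
      have e1 : (Gi * Matrix.of fun a c => g' a c (Pi.single j 1)).trace
          = 1 / 2 * ∑ a, ∑ c, Gi a c * innerForm (b c * b j - b j * b c) (b a)
            + 1 / 2 * ∑ a, ∑ c, Gi a c * innerForm (b a * b j - b j * b a) (b c) := by
        simp only [Matrix.trace, Matrix.diag_apply, Matrix.mul_apply, Matrix.of_apply, hg'2,
          Finset.mul_sum, ← Finset.sum_add_distrib]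
        exact Finset.sum_congr rfl fun a _ => Finset.sum_congr rfl fun c _ => by ring
      have e2 : ∑ a, ∑ c, Gi a c * innerForm (b c * b j - b j * b c) (b a)
          = ∑ a, ∑ c, Gi a c * innerForm (b a * b j - b j * b a) (b c) := by
        rw [Finset.sum_comm]
        exact Finset.sum_congr rfl fun a _ => Finset.sum_congr rfl fun c _ => by rw [hsy]
      rw [e1, e2]; ring
    rw [e]; exact huni (b j)
  have hdiv : ∀ c, ∑ j, ∑ a, Gi j a * g' a c (Pi.single j 1) = 0 := by
    intro c
    -- The first bracket is antisymmetric in the summation indices, the second has trace zero.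
    have e1 : ∑ j, ∑ a, Gi j a * g' a c (Pi.single j 1)
        = 1 / 2 * ∑ j, ∑ a, Gi j a * innerForm (b a * b j - b j * b a) (b c)
          - 1 / 2 * ∑ j, ∑ a, Gi j a * innerForm (b j * b c - b c * b j) (b a) := by
      simp only [hg'2, Finset.mul_sum, ← Finset.sum_sub_distrib]
      refine Finset.sum_congr rfl fun j _ => Finset.sum_congr rfl fun a _ => ?_
      rw [← neg_sub (b c * b j) (b j * b c), ← innerBilin_apply (-_), map_neg, LinearMap.neg_apply,
        innerBilin_apply]
      ring
    have e2 : ∑ j, ∑ a, Gi j a * innerForm (b a * b j - b j * b a) (b c)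
        = -∑ j, ∑ a, Gi j a * innerForm (b a * b j - b j * b a) (b c) := by
      conv_lhs => rw [Finset.sum_comm]
      simp only [← Finset.sum_neg_distrib]
      refine Finset.sum_congr rfl fun j _ => Finset.sum_congr rfl fun a _ => ?_
      rw [← neg_sub (b a * b j) (b j * b a), ← innerBilin_apply (-_), map_neg, LinearMap.neg_apply,
        innerBilin_apply, hsy]
      ring
    have e3 := huni (b c)
    rw [e1, e3]
    linarith
  refine (coordTension_zero_eq hg hf' hpd.det_pos hdet hdiv).trans ?_
  simp only [← hGi, hf'2]
  -- The symmetric coefficients `Gi` turn the symmetrized product into the product.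
  have e4 : ∀ j k, L (p * ((1 / 2 : ℝ) • (b j * b k + b k * b j)))
      = 1 / 2 * L (p * (b j * b k)) + 1 / 2 * L (p * (b k * b j)) := by
    intro j k
    rw [mul_smul_comm, map_smul, mul_add, map_add, Complex.real_smul]
    push_cast
    ring
  simp only [e4, mul_add, Finset.sum_add_distrib]
  have e5 : ∑ j, ∑ k, ((Gi j k : ℝ) : ℂ) * (1 / 2 * L (p * (b k * b j)))
      = ∑ j, ∑ k, ((Gi j k : ℝ) : ℂ) * (1 / 2 * L (p * (b j * b k))) := by
    rw [Finset.sum_comm]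
    exact Finset.sum_congr rfl fun a _ => Finset.sum_congr rfl fun c _ => by rw [hsy]
  rw [e5, ← two_mul, gramSum]
  simp only [Finset.mul_sum, LinearMap.compr₂_apply, LinearMap.mul_apply', LinearMap.comp_apply,
    LinearMap.mulLeft_apply, Complex.real_smul]
  refine Finset.sum_congr rfl fun a _ => Finset.sum_congr rfl fun c _ => ?_
  rw [hGi, h0]
  ring

/-- A linear function on a closed matrix group is an eigenfunction as soon as the two frame sums
of the orthogonal projection `P` onto the Lie algebra are the expected multiples; the Lie algebra
has to be stable under conjugate transposition. -/
theorem isEigenfunction_of_frameSum (hG : ∀ p ∈ G, IsUnit p.det)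
    {P : Matrix ι ι 𝕜 →ₗ[ℝ] Matrix ι ι 𝕜} (hexp : ∀ X, P X = X → NormedSpace.exp X ∈ G)
    (hidem : ∀ X, P (P X) = P X)
    (hlie : ∀ X, (∀ t : ℝ, NormedSpace.exp (t • X) ∈ G) → P X = X)
    (hsymm : ∀ Y Z, innerForm (P Y) Z = innerForm Y (P Z)) (hstar : ∀ Y, P Yᴴ = (P Y)ᴴ)
    (L : Matrix ι ι 𝕜 →ₗ[ℝ] ℂ) {lam mu : ℂ}
    (hlam : ∀ p ∈ G, frameSum P (fun X Y => L (p * (X * Y))) = lam * L p)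
    (hmu : ∀ p ∈ G, frameSum P (fun X Y => L (p * X) * L (p * Y)) = mu * L p ^ 2) :
    IsEigenfunction G L lam mu := by
  have hmem : ∀ Y, P Y ∈ lieAlgebra G := fun Y => Submodule.subset_span fun t =>
    hexp _ (by rw [map_smul, hidem])
  have hfix : ∀ X ∈ lieAlgebra G, P X = X := by
    intro X hX
    have : lieAlgebra G ≤ LinearMap.eqLocus P LinearMap.id :=
      Submodule.span_le.2 fun X hX => hlie X hX
    exact this hX
  intro p hp
  refine ⟨?_, ?_⟩
  · rw [tension_eq_gramSum (hG p hp) hmem hfix hsymm hstar,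
      gramSum_eq_frameSum _ hmem hfix hsymm]
    exact hlam p hp
  · rw [conformality_eq_gramSum (hG p hp), gramSum_eq_frameSum _ hmem hfix hsymm]
    exact hmu p hp

end MatrixGroup

/-! ### One-parameter subgroups and linear conditions on the Lie algebra -/

section OneParameter

theorem exp_smul_intertwine {A : Type*} [NormedRing A] [NormedAlgebra ℝ A] [CompleteSpace A]
    {X Y K : A} (h : ∀ t : ℝ, NormedSpace.exp (t • X) * K = K * NormedSpace.exp (t • Y)) :
    X * K = K * Y := by
  have h1 : HasDerivAt (fun t : ℝ => NormedSpace.exp (t • X) * K) (X * K) 0 := by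
    simpa using (hasDerivAt_exp_smul_const (𝕂 := ℝ) X 0).mul_const K
  have h2 : HasDerivAt (fun t : ℝ => K * NormedSpace.exp (t • Y)) (K * Y) 0 := by
    simpa using (hasDerivAt_exp_smul_const (𝕂 := ℝ) Y 0).const_mul K
  simp only [h] at h1
  exact h1.unique h2

theorem hasDerivAt_exp_sub_smul {A : Type*} [NormedRing A] [NormedAlgebra ℝ A] [CompleteSpace A]
    (X : A) (t : ℝ) : HasDerivAt (fun s : ℝ => NormedSpace.exp ((s - t) • X)) X t := by
  have h : HasDerivAt (fun s : ℝ => NormedSpace.exp (s • X)) X (t - t) := by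
    simpa using hasDerivAt_exp_smul_const (𝕂 := ℝ) X (t - t)
  exact h.comp_sub_const t t

theorem exp_intertwine {A : Type*} [NormedRing A] [NormedAlgebra ℝ A] [CompleteSpace A]
    {X Y K : A} (h : X * K = K * Y) : NormedSpace.exp X * K = K * NormedSpace.exp Y := by
  let : NormedAlgebra ℚ A := NormedAlgebra.restrictScalars ℚ ℝ A
  exact (SemiconjBy.exp_right (x := K) (a := Y) (b := X) h.symm).symm

variable {𝕜 ι : Type*} [RCLike 𝕜] [Fintype ι] [DecidableEq ι]

open scoped Matrix.Norms.Operator in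
/-- `X` is infinitesimally intertwined with `Y` by `K` if and only if the one-parameter groups
are. -/
theorem matrix_exp_intertwine_iff {X Y K : Matrix ι ι 𝕜} :
    (∀ t : ℝ, NormedSpace.exp (t • X) * K = K * NormedSpace.exp (t • Y)) ↔ X * K = K * Y :=
  ⟨fun h => exp_smul_intertwine h, fun h t => exp_intertwine (by
    rw [smul_mul_assoc, mul_smul_comm, h])⟩

open scoped Matrix.Norms.Operator in
theorem hasDerivAt_det_exp (X : Matrix ι ι 𝕜) (t : ℝ) :
    HasDerivAt (fun s : ℝ => (NormedSpace.exp (s • X)).det)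
      ((NormedSpace.exp (t • X)).det * X.trace) t := by
  have h1 : ∀ i j, HasDerivAt (fun s : ℝ => (NormedSpace.exp ((s - t) • X)) i j) (X i j) t := by
    intro i j
    exact (Matrix.entryLinearMap ℝ 𝕜 i j).toContinuousLinearMap.hasFDerivAt.comp_hasDerivAt t
      (hasDerivAt_exp_sub_smul X t)
  have h2 := (hasFDerivAt_det_of_eq_one (E := ℝ)
    (M := fun s : ℝ => (NormedSpace.exp ((s - t) • X) : Matrix ι ι 𝕜))
    (fun i j => (h1 i j).hasFDerivAt) (by simp)).hasDerivAt
  have h3 := h2.const_mul (NormedSpace.exp (t • X)).det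
  have e : ∀ s : ℝ, (NormedSpace.exp (s • X) : Matrix ι ι 𝕜).det
      = (NormedSpace.exp (t • X) : Matrix ι ι 𝕜).det
        * (NormedSpace.exp ((s - t) • X) : Matrix ι ι 𝕜).det := by
    intro s
    let : NormedAlgebra ℚ 𝕜 := NormedAlgebra.restrictScalars ℚ ℝ 𝕜
    rw [← Matrix.det_mul, ← Matrix.exp_add_of_commute _ _
      ((Commute.refl X).smul_left t |>.smul_right (s - t)), ← add_smul, add_sub_cancel]
  refine (h3.congr_of_eventuallyEq (Filter.Eventually.of_forall e)).congr_deriv ?_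
  simp [Matrix.trace]

theorem det_exp_of_trace_eq_zero {X : Matrix ι ι 𝕜} (hX : X.trace = 0) :
    (NormedSpace.exp X).det = 1 := by
  have h : ∀ t : ℝ, HasDerivAt (fun s : ℝ => (NormedSpace.exp (s • X)).det) 0 t := fun t => by
    simpa [hX] using hasDerivAt_det_exp X t
  have hc := is_const_of_deriv_eq_zero (fun t => (h t).differentiableAt) (fun t => (h t).deriv) 1 0
  simpa using hc

theorem trace_eq_zero_of_det_exp {X : Matrix ι ι 𝕜}
    (h : ∀ t : ℝ, (NormedSpace.exp (t • X)).det = 1) : X.trace = 0 := by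
  have h1 := hasDerivAt_det_exp X 0
  simp only [h, one_mul] at h1
  exact h1.unique (hasDerivAt_const (0 : ℝ) (1 : 𝕜))

/-- The infinitesimal form of `x K x* = K`. -/
theorem exp_mul_mul_conjTranspose_iff {X K : Matrix ι ι 𝕜} :
    (∀ t : ℝ, NormedSpace.exp (t • X) * K * (NormedSpace.exp (t • X))ᴴ = K)
      ↔ X * K = -(K * Xᴴ) := by
  rw [← mul_neg, ← matrix_exp_intertwine_iff]
  refine forall_congr' fun t => ?_
  let : NormedAlgebra ℚ 𝕜 := NormedAlgebra.restrictScalars ℚ ℝ 𝕜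
  have hu : IsUnit (NormedSpace.exp (t • Xᴴ) : Matrix ι ι 𝕜).det :=
    (Matrix.isUnit_iff_isUnit_det _).1 (Matrix.isUnit_exp _)
  rw [← Matrix.exp_conjTranspose, Matrix.conjTranspose_smul, star_trivial, smul_neg,
    Matrix.exp_neg]
  constructor
  · intro h
    conv_rhs => rw [← h]
    rw [Matrix.mul_nonsing_inv_cancel_right _ _ hu]
  · intro h
    rw [h, Matrix.nonsing_inv_mul_cancel_right _ _ hu]

/-- The infinitesimal form of `x K = K x̄`, where `x̄ = (x*)ᵗ`. -/
theorem exp_mul_eq_mul_conj_iff {X K : Matrix ι ι 𝕜} :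
    (∀ t : ℝ, NormedSpace.exp (t • X) * K = K * (NormedSpace.exp (t • X))ᴴᵀ)
      ↔ X * K = K * Xᴴᵀ := by
  rw [← matrix_exp_intertwine_iff]
  refine forall_congr' fun t => ?_
  let : NormedAlgebra ℚ 𝕜 := NormedAlgebra.restrictScalars ℚ ℝ 𝕜
  rw [← Matrix.exp_conjTranspose, ← Matrix.exp_transpose, Matrix.conjTranspose_smul, star_trivial,
    Matrix.transpose_smul]

end OneParameter

/-! ### Orthogonal projections of matrices -/

section FixProj

variable {𝕜 ι : Type*} [RCLike 𝕜]

/-- The projection `(1 + θ) / 2` onto the fixed space of an involution `θ`. -/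
def fixProj (θ : Module.End ℝ (Matrix ι ι 𝕜)) : Module.End ℝ (Matrix ι ι 𝕜) :=
  (1 / 2 : ℝ) • (1 + θ)

theorem fixProj_apply (θ : Module.End ℝ (Matrix ι ι 𝕜)) (X : Matrix ι ι 𝕜) :
    fixProj θ X = (1 / 2 : ℝ) • (X + θ X) := rfl

theorem fixProj_eq_self {θ : Module.End ℝ (Matrix ι ι 𝕜)} {X : Matrix ι ι 𝕜} :
    fixProj θ X = X ↔ θ X = X := by
  rw [fixProj_apply]
  constructor
  · intro h
    have h2 : X + θ X = X + X := by
      conv_rhs => rw [← h, ← add_smul]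
      norm_num
    exact add_left_cancel h2
  · intro h
    rw [h, ← two_smul ℝ X, smul_smul]
    norm_num

/-- `Xᴴᵀ` is the entrywise conjugate of `X`. -/
theorem conj_conj (X : Matrix ι ι 𝕜) : Xᴴᵀᴴᵀ = X := by
  ext i j
  simp

end FixProj

section OrthProj

variable {𝕜 ι : Type*} [RCLike 𝕜] [Fintype ι]

theorem innerForm_smul_left (c : ℝ) (X Y : Matrix ι ι 𝕜) :
    innerForm (c • X) Y = c * innerForm X Y := by
  rw [← innerBilin_apply, map_smul]; rfl

theorem innerForm_add_left (X X' Y : Matrix ι ι 𝕜) :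
    innerForm (X + X') Y = innerForm X Y + innerForm X' Y := by
  rw [← innerBilin_apply, map_add]; rfl

theorem innerForm_sub_left (X X' Y : Matrix ι ι 𝕜) :
    innerForm (X - X') Y = innerForm X Y - innerForm X' Y := by
  rw [← innerBilin_apply, map_sub]; rfl

theorem innerForm_smul_right (c : ℝ) (X Y : Matrix ι ι 𝕜) :
    innerForm X (c • Y) = c * innerForm X Y := by
  rw [innerForm_comm, innerForm_smul_left, innerForm_comm]

theorem innerForm_add_right (X Y Y' : Matrix ι ι 𝕜) :
    innerForm X (Y + Y') = innerForm X Y + innerForm X Y' := by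
  rw [innerForm_comm, innerForm_add_left, innerForm_comm Y, innerForm_comm Y']

theorem innerForm_sub_right (X Y Y' : Matrix ι ι 𝕜) :
    innerForm X (Y - Y') = innerForm X Y - innerForm X Y' := by
  rw [innerForm_comm, innerForm_sub_left, innerForm_comm Y, innerForm_comm Y']

theorem innerForm_conjTranspose (X Y : Matrix ι ι 𝕜) : innerForm Xᴴ Yᴴ = innerForm X Y := by
  rw [innerForm_comm X, innerForm, innerForm, Matrix.conjTranspose_conjTranspose,
    Matrix.trace_mul_comm]

theorem innerForm_mul_left (A X Y : Matrix ι ι 𝕜) :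
    innerForm (A * X) Y = innerForm X (Aᴴ * Y) := by
  rw [innerForm, innerForm, Matrix.conjTranspose_mul, Matrix.conjTranspose_conjTranspose,
    mul_assoc, Matrix.trace_mul_comm, mul_assoc]

theorem innerForm_mul_right (A X Y : Matrix ι ι 𝕜) :
    innerForm (X * A) Y = innerForm X (Y * Aᴴ) := by
  rw [innerForm, innerForm, Matrix.conjTranspose_mul, Matrix.conjTranspose_conjTranspose,
    mul_assoc]

theorem innerForm_conj (X Y : Matrix ι ι 𝕜) : innerForm Xᴴᵀ Yᴴᵀ = innerForm X Y := by
  simp [innerForm_apply]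

/-- `P` is an orthogonal projection for `innerForm` that commutes with conjugate transposition. -/
structure IsOrthProj (P : Module.End ℝ (Matrix ι ι 𝕜)) : Prop where
  idem : ∀ X, P (P X) = P X
  symm : ∀ X Y, innerForm (P X) Y = innerForm X (P Y)
  star : ∀ X, P Xᴴ = (P X)ᴴ

/-- `θ` is a symmetric involution for `innerForm` that commutes with conjugate transposition. -/
structure IsSymmInvolution (θ : Module.End ℝ (Matrix ι ι 𝕜)) : Prop where
  invol : ∀ X, θ (θ X) = X
  symm : ∀ X Y, innerForm (θ X) Y = innerForm X (θ Y)
  star : ∀ X, θ Xᴴ = (θ X)ᴴ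

theorem IsSymmInvolution.isOrthProj {θ : Module.End ℝ (Matrix ι ι 𝕜)} (h : IsSymmInvolution θ) :
    IsOrthProj (fixProj θ) where
  idem X := by
    rw [fixProj_eq_self, fixProj_apply, map_smul, map_add, h.invol, add_comm]
  symm X Y := by
    rw [fixProj_apply, fixProj_apply, innerForm_smul_left, innerForm_smul_right,
      innerForm_add_left, innerForm_add_right, h.symm]
  star X := by
    rw [fixProj_apply, fixProj_apply, h.star, Matrix.conjTranspose_smul, star_trivial,
      Matrix.conjTranspose_add]

theorem isOrthProj_one : IsOrthProj (1 : Module.End ℝ (Matrix ι ι 𝕜)) :=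
  ⟨fun _ => rfl, fun _ _ => rfl, fun _ => rfl⟩

theorem IsOrthProj.mul {P Q : Module.End ℝ (Matrix ι ι 𝕜)} (hP : IsOrthProj P)
    (hQ : IsOrthProj Q) (h : ∀ X, P (Q X) = Q (P X)) : IsOrthProj (P * Q) where
  idem X := by
    simp only [Module.End.mul_apply]
    rw [← h (Q X), hQ.idem, hP.idem]
  symm X Y := by
    simp only [Module.End.mul_apply]
    rw [hP.symm, hQ.symm, h]
  star X := by
    simp only [Module.End.mul_apply]
    rw [hQ.star, hP.star]

theorem IsOrthProj.mul_eq_self {P Q : Module.End ℝ (Matrix ι ι 𝕜)} (hP : IsOrthProj P)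
    (hQ : IsOrthProj Q) (h : ∀ X, P (Q X) = Q (P X)) {X : Matrix ι ι 𝕜} :
    (P * Q) X = X ↔ P X = X ∧ Q X = X := by
  rw [Module.End.mul_apply]
  refine ⟨fun hX => ⟨?_, ?_⟩, fun ⟨h1, h2⟩ => by rw [h2, h1]⟩
  · rw [← hX, hP.idem]
  · rw [← hX, h, hQ.idem]

/-- The orthogonal projection onto the line spanned by `D` (which is zero for `D = 0`, by the
convention for division by zero). -/
def lineProj (D : Matrix ι ι 𝕜) : Module.End ℝ (Matrix ι ι 𝕜) :=
  (1 / innerForm D D) • (innerBilin 𝕜 ι D).smulRight D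

theorem lineProj_apply (D X : Matrix ι ι 𝕜) :
    lineProj D X = (1 / innerForm D D) • innerForm D X • D := rfl

theorem lineProj_eq_zero {D X : Matrix ι ι 𝕜} : lineProj D X = 0 ↔ innerForm D X = 0 := by
  rw [lineProj_apply]
  refine ⟨fun h => ?_, fun h => by rw [h, zero_smul, smul_zero]⟩
  by_cases hD : D = 0
  · rw [hD, innerForm, zero_mul, Matrix.trace_zero, map_zero]
  · have := (innerForm_self_pos hD).ne'
    simpa [hD, this] using h

theorem lineProj_self (D : Matrix ι ι 𝕜) : lineProj D D = D := by
  rw [lineProj_apply]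
  by_cases hD : D = 0
  · rw [hD, smul_zero, smul_zero]
  · rw [smul_smul, one_div, inv_mul_cancel₀ (innerForm_self_pos hD).ne', one_smul]

/-- Removing from an orthogonal projection a line contained in its range. -/
theorem IsOrthProj.sub_lineProj {P : Module.End ℝ (Matrix ι ι 𝕜)} (hP : IsOrthProj P)
    {D : Matrix ι ι 𝕜} (hD : P D = D) (hstar : Dᴴ = D ∨ Dᴴ = -D) :
    IsOrthProj (P - lineProj D) ∧
      ∀ X, (P - lineProj D) X = X ↔ P X = X ∧ innerForm D X = 0 := by
  have h1 : ∀ X, P (lineProj D X) = lineProj D X := fun X => by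
    rw [lineProj_apply, map_smul, map_smul, hD]
  have h2 : ∀ X, lineProj D (P X) = lineProj D X := fun X => by
    rw [lineProj_apply, lineProj_apply, ← hP.symm, hD]
  have h3 : ∀ X, lineProj D (lineProj D X) = lineProj D X := fun X => by
    conv_lhs => rw [lineProj_apply D X, map_smul, map_smul, lineProj_self]
    rfl
  refine ⟨⟨fun X => ?_, fun X Y => ?_, fun X => ?_⟩, fun X => ⟨fun h => ?_, fun h => ?_⟩⟩
  · simp only [LinearMap.sub_apply, map_sub, hP.idem, h1, h2, h3, sub_self, sub_zero]
  · simp only [LinearMap.sub_apply, innerForm_sub_left, innerForm_sub_right, hP.symm,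
      lineProj_apply, innerForm_smul_left, innerForm_smul_right]
    rw [innerForm_comm X D]
    ring
  · simp only [LinearMap.sub_apply, hP.star, Matrix.conjTranspose_sub, lineProj_apply,
      Matrix.conjTranspose_smul, star_trivial]
    have h4 : innerForm D Xᴴ = innerForm Dᴴ X := by
      rw [← innerForm_conjTranspose, Matrix.conjTranspose_conjTranspose]
    rcases hstar with h | h
    · rw [h4, h]
    · have h5 : innerForm (-D) X = -innerForm D X := by
        rw [← neg_one_smul ℝ D, innerForm_smul_left, neg_one_mul]
      rw [h4, h, h5, neg_smul, smul_neg, smul_neg, smul_neg]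
  · have h5 : P X = X := by
      conv_lhs => rw [← h]
      rw [LinearMap.sub_apply, map_sub, hP.idem, h1]
      exact h
    rw [LinearMap.sub_apply, h5, sub_eq_self] at h
    exact ⟨h5, lineProj_eq_zero.1 h⟩
  · rw [LinearMap.sub_apply, h.1, lineProj_eq_zero.2 h.2, sub_zero]

/-- `Y ↦ -K Y* K*`. For unitary `K` with `K* = ±K`, its fixed space is the Lie algebra of the group
`x K x* = K`. -/
def adjInv (K : Matrix ι ι 𝕜) : Module.End ℝ (Matrix ι ι 𝕜) where
  toFun Y := -(K * Yᴴ * Kᴴ)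
  map_add' Y Z := by
    rw [Matrix.conjTranspose_add, mul_add, add_mul, neg_add]
  map_smul' c Y := by
    rw [Matrix.conjTranspose_smul, star_trivial, mul_smul_comm, smul_mul_assoc, RingHom.id_apply,
      smul_neg]

theorem adjInv_apply (K Y : Matrix ι ι 𝕜) : adjInv K Y = -(K * Yᴴ * Kᴴ) := rfl

/-- `Y ↦ -J Ȳ J`. For `J² = -1`, its fixed space consists of the matrices with `Y J = J Ȳ`. -/
def conjInv (J : Matrix ι ι 𝕜) : Module.End ℝ (Matrix ι ι 𝕜) where
  toFun Y := -(J * Yᴴᵀ * J)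
  map_add' Y Z := by
    rw [Matrix.conjTranspose_add, Matrix.transpose_add, mul_add, add_mul, neg_add]
  map_smul' c Y := by
    rw [Matrix.conjTranspose_smul, star_trivial, Matrix.transpose_smul, mul_smul_comm,
      smul_mul_assoc, RingHom.id_apply, smul_neg]

theorem conjInv_apply (J Y : Matrix ι ι 𝕜) : conjInv J Y = -(J * Yᴴᵀ * J) := rfl

theorem conj_sandwich {J : Matrix ι ι 𝕜} (hJr : Jᴴᵀ = J) (Y : Matrix ι ι 𝕜) :
    (J * Y * J)ᴴᵀ = J * Yᴴᵀ * J := by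
  simp only [Matrix.conjTranspose_mul, Matrix.transpose_mul, hJr]

variable [DecidableEq ι]

theorem adjInv_isSymmInvolution {K : Matrix ι ι 𝕜} (hK : K * Kᴴ = 1) (hK' : Kᴴ = K ∨ Kᴴ = -K) :
    IsSymmInvolution (adjInv K) where
  invol X := by
    simp only [adjInv_apply, Matrix.conjTranspose_neg, Matrix.conjTranspose_mul,
      Matrix.conjTranspose_conjTranspose, mul_neg, neg_mul, neg_neg]
    rcases hK' with h | h
    · rw [h] at hK ⊢
      calc K * (K * (X * K)) * K = (K * K) * X * (K * K) := by simp only [mul_assoc]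
        _ = X := by rw [hK, one_mul, mul_one]
    · rw [h] at hK ⊢
      calc K * (K * (X * -K)) * -K = (K * -K) * X * (K * -K) := by
            simp only [mul_assoc, neg_mul, mul_neg, neg_neg]
        _ = X := by rw [hK, one_mul, mul_one]
  symm X Y := by
    have h1 : innerForm X (adjInv K Y) = innerForm (adjInv K Y) X := innerForm_comm _ _
    rw [h1]
    simp only [adjInv_apply, innerForm, neg_mul, Matrix.trace_neg]
    congr 2
    rw [Matrix.trace_mul_comm, ← mul_assoc, ← mul_assoc, Matrix.trace_mul_comm]
    rcases hK' with h | h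
    · rw [h]; simp only [mul_assoc]
    · rw [h]; simp only [mul_assoc, neg_mul, mul_neg]
  star X := by
    simp only [adjInv_apply, Matrix.conjTranspose_neg, Matrix.conjTranspose_mul,
      Matrix.conjTranspose_conjTranspose, mul_assoc]

theorem adjInv_eq_self {K X : Matrix ι ι 𝕜} (hK : K * Kᴴ = 1) :
    adjInv K X = X ↔ X * K = -(K * Xᴴ) := by
  have hK2 : Kᴴ * K = 1 := mul_eq_one_comm.1 hK
  rw [adjInv_apply]
  constructor
  · intro h
    conv_lhs => rw [← h]
    rw [neg_mul, mul_assoc, hK2, mul_one]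
  · intro h
    rw [← neg_mul, ← h, mul_assoc, hK, mul_one]

theorem conjInv_isSymmInvolution {J : Matrix ι ι 𝕜} (hJ : J * J = -1) (hJr : Jᴴᵀ = J)
    (hJt : Jᵀ = -J) : IsSymmInvolution (conjInv J) where
  invol X := by
    rw [conjInv_apply, conjInv_apply, Matrix.conjTranspose_neg, Matrix.transpose_neg,
      conj_sandwich hJr, conj_conj, mul_neg, neg_mul, neg_neg]
    calc J * (J * X * J) * J = (J * J) * X * (J * J) := by simp only [mul_assoc]
      _ = X := by rw [hJ, neg_one_mul, mul_neg_one, neg_neg]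
  symm X Y := by
    have hJh : Jᴴ = -J := by
      rw [← hJt, ← hJr, Matrix.transpose_transpose, hJr]
    have h1 : ∀ Z W : Matrix ι ι 𝕜, innerForm (-Z) W = -innerForm Z W := fun Z W => by
      rw [← innerBilin_apply, map_neg]; rfl
    rw [conjInv_apply, conjInv_apply, h1, innerForm_comm X, h1, innerForm_mul_right,
      innerForm_mul_left, hJh, neg_mul, mul_neg, mul_neg, neg_neg, ← mul_assoc, innerForm_comm,
      ← innerForm_conj, conj_sandwich hJr, conj_conj]
  star X := by
    have hJh : Jᴴ = -J := by
      rw [← hJt, ← hJr, Matrix.transpose_transpose, hJr]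
    have h : Xᴴᵀᴴ = Xᴴᴴᵀ := rfl
    rw [conjInv_apply, conjInv_apply, Matrix.conjTranspose_neg, Matrix.conjTranspose_mul,
      Matrix.conjTranspose_mul, hJh, h, neg_mul, mul_neg, mul_neg, neg_neg, mul_assoc]

theorem conjInv_eq_self {J X : Matrix ι ι 𝕜} (hJ : J * J = -1) :
    conjInv J X = X ↔ X * J = J * Xᴴᵀ := by
  rw [conjInv_apply]
  constructor
  · intro h
    conv_lhs => rw [← h]
    rw [neg_mul, mul_assoc, hJ, mul_neg, mul_one, neg_neg]
  · intro h
    rw [← h, mul_assoc, hJ, mul_neg, mul_one, neg_neg]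

end OrthProj

/-! ### Matrix units and frame sums -/

section MatrixUnits

variable {𝕜 ι : Type*} [RCLike 𝕜]

theorem toC_transpose (X : Matrix ι ι ℝ) : toC Xᵀ = (toC X)ᵀ := rfl

variable [DecidableEq ι]

theorem toC_one : toC (1 : Matrix ι ι ℝ) = 1 :=
  Matrix.map_one _ Complex.ofReal_zero Complex.ofReal_one

theorem toC_single_one (r s : ι) : toC (Matrix.single r s (1 : ℝ)) = Matrix.single r s 1 := by
  ext i j
  simp only [toC, Matrix.map_apply, Matrix.single_apply]
  split_ifs <;> simp

theorem single_I (r s : ι) :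
    Matrix.single r s (RCLike.I : ℂ) = Complex.I • Matrix.single r s (1 : ℂ) := by
  rw [Matrix.smul_single, smul_eq_mul, mul_one]
  rfl

theorem conjTranspose_single_one (r s : ι) :
    (Matrix.single r s (1 : 𝕜))ᴴ = (Matrix.single r s (1 : 𝕜))ᵀ := by
  rw [Matrix.conjTranspose_single, Matrix.transpose_single, star_one]

end MatrixUnits

section Traces

variable {ι : Type*} [Fintype ι]

theorem toC_mul (X Y : Matrix ι ι ℝ) : toC (X * Y) = toC X * toC Y :=
  Matrix.map_mul (f := Complex.ofRealHom)

theorem trace_mul_transpose (M N : Matrix ι ι ℂ) :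
    (M * Nᵀ).trace = ∑ r, ∑ s, M r s * N r s := by
  simp [Matrix.trace, Matrix.mul_apply]

end Traces

section FrameSums

variable {𝕜 ι : Type*} [RCLike 𝕜] [Fintype ι] [DecidableEq ι]
  {W : Type*} [AddCommGroup W] [Module ℝ W]

/-- `frameSum` as a linear function of the first argument. -/
def frameSumMap (β : Matrix ι ι 𝕜 →ₗ[ℝ] Matrix ι ι 𝕜 →ₗ[ℝ] W) :
    Module.End ℝ (Matrix ι ι 𝕜) →ₗ[ℝ] W where
  toFun P := frameSum P (fun X Y => β X Y)
  map_add' P Q := by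
    simp only [frameSum, ← Finset.sum_add_distrib]
    refine Finset.sum_congr rfl fun r _ => Finset.sum_congr rfl fun s _ => ?_
    simp only [LinearMap.add_apply, map_add]
    abel
  map_smul' c P := by
    simp only [frameSum, Finset.smul_sum, smul_add, RingHom.id_apply]
    refine Finset.sum_congr rfl fun r _ => Finset.sum_congr rfl fun s _ => ?_
    simp only [LinearMap.smul_apply, map_smul]

theorem frameSumMap_apply (β : Matrix ι ι 𝕜 →ₗ[ℝ] Matrix ι ι 𝕜 →ₗ[ℝ] W)
    (P : Module.End ℝ (Matrix ι ι 𝕜)) :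
    frameSumMap β P = ∑ r, ∑ s, (β (P (Matrix.single r s 1)) (Matrix.single r s 1)
      + β (P (Matrix.single r s RCLike.I)) (Matrix.single r s RCLike.I)) := rfl

/-- The frame sum of the projection onto a line has a single term. -/
theorem frameSumMap_lineProj (β : Matrix ι ι 𝕜 →ₗ[ℝ] Matrix ι ι 𝕜 →ₗ[ℝ] W) (D : Matrix ι ι 𝕜) :
    frameSumMap β (lineProj D) = (1 / innerForm D D) • β D D := by
  have h : β D D = β D (∑ r, ∑ s,
      (innerForm D (Matrix.single r s 1) • (Matrix.single r s 1 : Matrix ι ι 𝕜)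
      + innerForm D (Matrix.single r s RCLike.I) • Matrix.single r s RCLike.I)) := by
    rw [sum_innerForm_single]
  rw [h, frameSumMap_apply]
  simp only [lineProj_apply, map_sum, map_add, map_smul, LinearMap.smul_apply, Finset.smul_sum,
    smul_add]

/-- The matrix `∑ (PY) Y`, for `P` the projection onto a Lie algebra its Casimir element. -/
def casimir : Module.End ℝ (Matrix ι ι 𝕜) →ₗ[ℝ] Matrix ι ι 𝕜 :=
  frameSumMap (LinearMap.mul ℝ (Matrix ι ι 𝕜))

/-- The number `∑ L(PY) L(Y)` for a linear function `L`. -/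
def squareSum (L : Matrix ι ι 𝕜 →ₗ[ℝ] ℂ) : Module.End ℝ (Matrix ι ι 𝕜) →ₗ[ℝ] ℂ :=
  frameSumMap ((LinearMap.mul ℝ ℂ).compl₁₂ L L)

theorem casimir_apply (P : Module.End ℝ (Matrix ι ι 𝕜)) :
    casimir P = ∑ r, ∑ s, (P (Matrix.single r s 1) * Matrix.single r s 1
      + P (Matrix.single r s RCLike.I) * Matrix.single r s RCLike.I) := rfl

theorem squareSum_apply (L : Matrix ι ι 𝕜 →ₗ[ℝ] ℂ) (P : Module.End ℝ (Matrix ι ι 𝕜)) :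
    squareSum L P = ∑ r, ∑ s,
      (L (P (Matrix.single r s 1)) * L (Matrix.single r s 1)
      + L (P (Matrix.single r s RCLike.I)) * L (Matrix.single r s RCLike.I)) := rfl

theorem casimir_lineProj (D : Matrix ι ι 𝕜) :
    casimir (lineProj D) = (1 / innerForm D D) • (D * D) :=
  frameSumMap_lineProj _ D

theorem squareSum_lineProj (L : Matrix ι ι 𝕜 →ₗ[ℝ] ℂ) (D : Matrix ι ι 𝕜) :
    squareSum L (lineProj D) = (1 / innerForm D D) • (L D * L D) :=
  frameSumMap_lineProj _ D

/-! ### Sums over matrix units -/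

theorem sum_single_transpose (A B : Matrix ι ι 𝕜) :
    ∑ r, ∑ s, A * (Matrix.single r s (1 : 𝕜))ᵀ * B * Matrix.single r s 1 = B.trace • A := by
  have h : ∀ r s, A * (Matrix.single r s (1 : 𝕜))ᵀ * B * Matrix.single r s 1
      = A * (B r r • Matrix.single s s 1) := by
    intro r s
    rw [Matrix.transpose_single, mul_assoc, mul_assoc, ← mul_assoc _ B,
      Matrix.single_mul_mul_single, one_mul, mul_one, Matrix.smul_single, smul_eq_mul, mul_one]
  simp only [h, ← Finset.mul_sum, ← Finset.smul_sum]
  have h1 : ∑ s, Matrix.single s s (1 : 𝕜) = (1 : Matrix ι ι 𝕜) :=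
    Matrix.sum_single_one
  simp only [h1, ← Finset.sum_smul, mul_smul_comm, mul_one]
  rfl

theorem sum_single_same (A B : Matrix ι ι 𝕜) :
    ∑ r, ∑ s, A * Matrix.single r s (1 : 𝕜) * B * Matrix.single r s 1 = A * Bᵀ := by
  have h : ∀ r s, A * Matrix.single r s (1 : 𝕜) * B * Matrix.single r s 1
      = A * Matrix.single r s (Bᵀ r s) := by
    intro r s
    rw [mul_assoc, mul_assoc, ← mul_assoc _ B,
      Matrix.single_mul_mul_single, one_mul, mul_one, Matrix.transpose_apply]
  simp only [h, ← Finset.mul_sum]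
  rw [← Matrix.matrix_eq_sum_single]

theorem trace_mul_transpose_single (N : Matrix ι ι ℂ) (r s : ι) :
    (N * (Matrix.single r s (1 : ℂ))ᵀ).trace = N r s := by
  rw [Matrix.transpose_single, Matrix.trace_mul_single]
  simp

theorem sum_trace_single_same (N A B : Matrix ι ι ℂ) :
    ∑ r, ∑ s, (N * (A * Matrix.single r s 1 * B)ᵀ).trace * (N * (Matrix.single r s 1)ᵀ).trace
      = (Aᵀ * N * Bᵀ * Nᵀ).trace := by
  rw [trace_mul_transpose]
  refine Finset.sum_congr rfl fun r _ => Finset.sum_congr rfl fun s _ => ?_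
  rw [trace_mul_transpose_single, ← trace_mul_transpose_single (Aᵀ * N * Bᵀ) r s,
    Matrix.transpose_mul, Matrix.transpose_mul, ← mul_assoc, ← mul_assoc, Matrix.trace_mul_comm]
  simp only [mul_assoc]

theorem sum_trace_single_transpose (N A B : Matrix ι ι ℂ) :
    ∑ r, ∑ s, (N * (A * (Matrix.single r s 1)ᵀ * B)ᵀ).trace * (N * (Matrix.single r s 1)ᵀ).trace
      = (B * Nᵀ * A * Nᵀ).trace := by
  rw [trace_mul_transpose]
  refine Finset.sum_congr rfl fun r _ => Finset.sum_congr rfl fun s _ => ?_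
  rw [trace_mul_transpose_single, ← trace_mul_transpose_single (B * Nᵀ * A) r s,
    ← Matrix.trace_transpose, Matrix.transpose_mul N, Matrix.transpose_transpose,
    ← Matrix.trace_mul_comm Nᵀ]
  rw [← mul_assoc Nᵀ, Matrix.trace_mul_comm _ B]
  simp only [mul_assoc]

/-! ### Frame sums over complex matrices

The contributions of `E` and `iE` cancel for complex linear maps and add up for antilinear ones. -/

theorem casimir_of_linear {T : Module.End ℝ (Matrix ι ι ℂ)}
    (hT : ∀ Y, T (Complex.I • Y) = Complex.I • T Y) : casimir T = 0 := by
  rw [casimir_apply]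
  refine Finset.sum_eq_zero fun r _ => Finset.sum_eq_zero fun s _ => ?_
  rw [single_I, hT, smul_mul_smul_comm, Complex.I_mul_I, neg_one_smul, add_neg_cancel]

theorem casimir_of_antilinear {T : Module.End ℝ (Matrix ι ι ℂ)}
    (hT : ∀ Y, T (Complex.I • Y) = -(Complex.I • T Y)) :
    casimir T = (2 : ℂ) • ∑ r, ∑ s, T (Matrix.single r s 1) * Matrix.single r s 1 := by
  rw [casimir_apply]
  simp only [Finset.smul_sum]
  refine Finset.sum_congr rfl fun r _ => Finset.sum_congr rfl fun s _ => ?_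
  rw [single_I, hT, neg_mul, smul_mul_smul_comm, Complex.I_mul_I, neg_one_smul, neg_neg, two_smul]

theorem squareSum_of_linear {L : Matrix ι ι ℂ →ₗ[ℝ] ℂ}
    (hL : ∀ Y, L (Complex.I • Y) = Complex.I * L Y) {T : Module.End ℝ (Matrix ι ι ℂ)}
    (hT : ∀ Y, T (Complex.I • Y) = Complex.I • T Y) : squareSum L T = 0 := by
  rw [squareSum_apply]
  refine Finset.sum_eq_zero fun r _ => Finset.sum_eq_zero fun s _ => ?_
  rw [single_I, hT, hL, hL, mul_mul_mul_comm, Complex.I_mul_I]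
  ring

theorem squareSum_of_antilinear {L : Matrix ι ι ℂ →ₗ[ℝ] ℂ}
    (hL : ∀ Y, L (Complex.I • Y) = Complex.I * L Y) {T : Module.End ℝ (Matrix ι ι ℂ)}
    (hT : ∀ Y, T (Complex.I • Y) = -(Complex.I • T Y)) :
    squareSum L T = 2 * ∑ r, ∑ s, L (T (Matrix.single r s 1)) * L (Matrix.single r s 1) := by
  rw [squareSum_apply]
  simp only [Finset.mul_sum]
  refine Finset.sum_congr rfl fun r _ => Finset.sum_congr rfl fun s _ => ?_
  rw [single_I, hT, map_neg, hL, hL, neg_mul, mul_mul_mul_comm, Complex.I_mul_I]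
  ring

theorem adjInv_I_smul (K Y : Matrix ι ι ℂ) :
    adjInv K (Complex.I • Y) = -(Complex.I • adjInv K Y) := by
  simp [adjInv_apply, Matrix.conjTranspose_smul]

theorem conjInv_I_smul (J Y : Matrix ι ι ℂ) :
    conjInv J (Complex.I • Y) = -(Complex.I • conjInv J Y) := by
  simp [conjInv_apply, Matrix.conjTranspose_smul]

theorem casimir_adjInv (K : Matrix ι ι ℂ) :
    casimir (adjInv K) = -((2 : ℂ) • Kᴴ.trace • K) := by
  rw [casimir_of_antilinear (adjInv_I_smul K)]
  simp only [adjInv_apply, conjTranspose_single_one, neg_mul, Finset.sum_neg_distrib,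
    sum_single_transpose, smul_neg]

theorem casimir_conjInv (J : Matrix ι ι ℂ) :
    casimir (conjInv J) = -((2 : ℂ) • (J * Jᵀ)) := by
  rw [casimir_of_antilinear (conjInv_I_smul J)]
  simp only [conjInv_apply, conjTranspose_single_one, Matrix.transpose_transpose, neg_mul,
    Finset.sum_neg_distrib, sum_single_same, smul_neg]

/-- The function `X ↦ tr(N Xᵗ)` on complex matrices. -/
def traceForm (N : Matrix ι ι ℂ) : Matrix ι ι ℂ →ₗ[ℝ] ℂ where
  toFun X := (N * Xᵀ).trace
  map_add' X Y := by rw [Matrix.transpose_add, mul_add, Matrix.trace_add]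
  map_smul' c X := by
    rw [Matrix.transpose_smul, mul_smul_comm, Matrix.trace_smul, RingHom.id_apply]

theorem traceForm_apply (N X : Matrix ι ι ℂ) : traceForm N X = (N * Xᵀ).trace := rfl

theorem traceForm_I_smul (N X : Matrix ι ι ℂ) :
    traceForm N (Complex.I • X) = Complex.I * traceForm N X := by
  rw [traceForm_apply, Matrix.transpose_smul, mul_smul_comm, Matrix.trace_smul, smul_eq_mul]
  rfl

theorem squareSum_adjInv (N K : Matrix ι ι ℂ) :
    squareSum (traceForm N) (adjInv K) = -(2 * (Kᴴ * Nᵀ * K * Nᵀ).trace) := by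
  rw [squareSum_of_antilinear (traceForm_I_smul N) (adjInv_I_smul K)]
  simp only [adjInv_apply, conjTranspose_single_one, map_neg, neg_mul, Finset.sum_neg_distrib,
    traceForm_apply, sum_trace_single_transpose, mul_neg]

theorem squareSum_conjInv (N J : Matrix ι ι ℂ) :
    squareSum (traceForm N) (conjInv J) = -(2 * (Jᵀ * N * Jᵀ * Nᵀ).trace) := by
  rw [squareSum_of_antilinear (traceForm_I_smul N) (conjInv_I_smul J)]
  simp only [conjInv_apply, conjTranspose_single_one, Matrix.transpose_transpose, map_neg, neg_mul,
    Finset.sum_neg_distrib, traceForm_apply, sum_trace_single_same, mul_neg]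

/-! ### Frame sums over real matrices -/

/-- The function `X ↦ tr(N Xᵗ)` on real matrices, with a complex matrix `N`. -/
def traceFormReal (N : Matrix ι ι ℂ) : Matrix ι ι ℝ →ₗ[ℝ] ℂ where
  toFun X := (N * (toC X)ᵀ).trace
  map_add' X Y := by
    have h : toC (X + Y) = toC X + toC Y := by ext; simp [toC]
    rw [h, Matrix.transpose_add, mul_add, Matrix.trace_add]
  map_smul' c X := by
    have h : toC (c • X) = c • toC X := by ext; simp [toC]
    rw [h, Matrix.transpose_smul, mul_smul_comm, Matrix.trace_smul, RingHom.id_apply]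

theorem traceFormReal_apply (N : Matrix ι ι ℂ) (X : Matrix ι ι ℝ) :
    traceFormReal N X = (N * (toC X)ᵀ).trace := rfl

theorem casimir_real (T : Module.End ℝ (Matrix ι ι ℝ)) :
    casimir T = ∑ r, ∑ s, T (Matrix.single r s 1) * Matrix.single r s 1 := by
  simp [casimir_apply]

theorem squareSum_real (L : Matrix ι ι ℝ →ₗ[ℝ] ℂ) (T : Module.End ℝ (Matrix ι ι ℝ)) :
    squareSum L T = ∑ r, ∑ s, L (T (Matrix.single r s 1)) * L (Matrix.single r s 1) := by
  simp [squareSum_apply]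

theorem casimir_one_real : casimir (1 : Module.End ℝ (Matrix ι ι ℝ)) = 1 := by
  have h := sum_single_same (1 : Matrix ι ι ℝ) 1
  simp only [mul_one, one_mul, Matrix.transpose_one] at h
  rw [casimir_real]
  exact h

theorem casimir_adjInv_real (K : Matrix ι ι ℝ) :
    casimir (adjInv K) = -(K.trace • K) := by
  rw [casimir_real]
  simp only [adjInv_apply, neg_mul, Finset.sum_neg_distrib, sum_single_transpose,
    Matrix.conjTranspose_eq_transpose_of_trivial, Matrix.trace_transpose]

theorem squareSum_one_real (N : Matrix ι ι ℂ) :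
    squareSum (traceFormReal N) 1 = (N * Nᵀ).trace := by
  have h := sum_trace_single_same N 1 1
  simp only [mul_one, one_mul, Matrix.transpose_one] at h
  rw [squareSum_real, ← h]
  simp only [Module.End.one_apply, traceFormReal_apply, toC_single_one]

theorem squareSum_adjInv_real (N : Matrix ι ι ℂ) (K : Matrix ι ι ℝ) :
    squareSum (traceFormReal N) (adjInv K)
      = -((toC K)ᵀ * Nᵀ * toC K * Nᵀ).trace := by
  rw [squareSum_real, ← sum_trace_single_transpose]
  simp only [adjInv_apply, map_neg, neg_mul, Finset.sum_neg_distrib, traceFormReal_apply, toC_mul,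
    toC_single_one, Matrix.conjTranspose_eq_transpose_of_trivial, toC_transpose]

end FrameSums

/-! ### Trace functions on families of matrix groups -/

section Families

variable {ι : Type*} [Fintype ι] [DecidableEq ι]

theorem frameSum_linear_mul {𝕜 : Type*} [RCLike 𝕜] (P : Module.End ℝ (Matrix ι ι 𝕜))
    (L : Matrix ι ι 𝕜 →ₗ[ℝ] ℂ) (p : Matrix ι ι 𝕜) :
    frameSum P (fun X Y => L (p * (X * Y))) = L (p * casimir P) := by
  simp only [frameSum, casimir_apply, Finset.mul_sum, mul_add, map_sum, map_add]

theorem traceForm_mul (M p X : Matrix ι ι ℂ) : traceForm M (p * X) = traceForm (pᵀ * M) X := by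
  rw [traceForm_apply, traceForm_apply, Matrix.transpose_mul, ← mul_assoc, Matrix.trace_mul_comm,
    mul_assoc]

theorem traceFormReal_mul (M : Matrix ι ι ℂ) (p X : Matrix ι ι ℝ) :
    traceFormReal M (p * X) = traceFormReal ((toC p)ᵀ * M) X := by
  rw [traceFormReal_apply, traceFormReal_apply, toC_mul, Matrix.transpose_mul, ← mul_assoc,
    Matrix.trace_mul_comm, mul_assoc]

/-- The criterion for complex matrix groups, with the left translation absorbed into `M`. -/
theorem isEigenfunction_trace {G : Set (Matrix ι ι ℂ)} (hG : ∀ p ∈ G, IsUnit p.det)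
    {P : Module.End ℝ (Matrix ι ι ℂ)} (hP : IsOrthProj P)
    (hexp : ∀ X, P X = X → NormedSpace.exp X ∈ G)
    (hlie : ∀ X, (∀ t : ℝ, NormedSpace.exp (t • X) ∈ G) → P X = X)
    {M : Matrix ι ι ℂ} {lam mu : ℂ} (hlam : M * (casimir P)ᵀ = lam • M)
    (hmu : ∀ p ∈ G, squareSum (traceForm (pᵀ * M)) P = mu * (M * pᵀ).trace ^ 2) :
    IsEigenfunction G (fun X => (M * Xᵀ).trace) lam mu := by
  refine isEigenfunction_of_frameSum hG hexp hP.idem hlie hP.symm hP.star (traceForm M)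
    (fun p _ => ?_) (fun p hp => ?_)
  · rw [frameSum_linear_mul, traceForm_apply, traceForm_apply, Matrix.transpose_mul, ← mul_assoc,
      hlam, smul_mul_assoc, Matrix.trace_smul, smul_eq_mul]
  · simp only [traceForm_mul]
    exact hmu p hp

/-- The criterion for real matrix groups. -/
theorem isEigenfunction_trace_real {G : Set (Matrix ι ι ℝ)} (hG : ∀ p ∈ G, IsUnit p.det)
    {P : Module.End ℝ (Matrix ι ι ℝ)} (hP : IsOrthProj P)
    (hexp : ∀ X, P X = X → NormedSpace.exp X ∈ G)
    (hlie : ∀ X, (∀ t : ℝ, NormedSpace.exp (t • X) ∈ G) → P X = X)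
    {M : Matrix ι ι ℂ} {lam mu : ℂ} (hlam : M * (toC (casimir P))ᵀ = lam • M)
    (hmu : ∀ p ∈ G, squareSum (traceFormReal ((toC p)ᵀ * M)) P
      = mu * (M * (toC p)ᵀ).trace ^ 2) :
    IsEigenfunction G (fun X => (M * (toC X)ᵀ).trace) lam mu := by
  refine isEigenfunction_of_frameSum hG hexp hP.idem hlie hP.symm hP.star (traceFormReal M)
    (fun p _ => ?_) (fun p hp => ?_)
  · rw [frameSum_linear_mul, traceFormReal_apply, traceFormReal_apply, toC_mul,
      Matrix.transpose_mul, ← mul_assoc, hlam, smul_mul_assoc, Matrix.trace_smul, smul_eq_mul]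
  · simp only [traceFormReal_mul]
    exact hmu p hp

theorem exp_mem_of_forall {𝕜 : Type*} [RCLike 𝕜] {X : Matrix ι ι 𝕜} {p : Matrix ι ι 𝕜 → Prop}
    (h : ∀ t : ℝ, p (NormedSpace.exp (t • X))) : p (NormedSpace.exp X) := by
  simpa using h 1

theorem innerForm_one_left {𝕜 : Type*} [RCLike 𝕜] (X : Matrix ι ι 𝕜) :
    innerForm 1 X = RCLike.re X.trace := by
  rw [innerForm_comm, innerForm, Matrix.conjTranspose_one, mul_one]

theorem innerForm_one_one {𝕜 : Type*} [RCLike 𝕜] :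
    innerForm (1 : Matrix ι ι 𝕜) 1 = Fintype.card ι := by
  rw [innerForm_one_left, Matrix.trace_one, RCLike.natCast_re]

theorem innerForm_I_left (X : Matrix ι ι ℂ) :
    innerForm (Complex.I • (1 : Matrix ι ι ℂ)) X = X.trace.im := by
  rw [innerForm_comm, innerForm, Matrix.conjTranspose_smul, Matrix.conjTranspose_one,
    mul_smul_comm, mul_one, Matrix.trace_smul]
  simp

theorem innerForm_I_I : innerForm (Complex.I • (1 : Matrix ι ι ℂ)) (Complex.I • 1)
    = Fintype.card ι := by
  rw [innerForm_I_left, Matrix.trace_smul, Matrix.trace_one]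
  simp

/-- In the Lie algebra of `x K x* = K` all traces are imaginary. -/
theorem trace_re_eq_zero_of_adjInv {𝕜 : Type*} [RCLike 𝕜] {K X : Matrix ι ι 𝕜} (hK : K * Kᴴ = 1)
    (hX : adjInv K X = X) : RCLike.re X.trace = 0 := by
  rw [adjInv_apply] at hX
  have h := congrArg RCLike.re (congrArg Matrix.trace hX)
  rw [Matrix.trace_neg, mul_assoc, Matrix.trace_mul_comm, mul_assoc, mul_eq_one_comm.1 hK,
    mul_one, Matrix.trace_conjTranspose, map_neg, RCLike.star_def, RCLike.conj_re] at h
  linarith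

/-- Quaternionic matrices have real traces. -/
theorem trace_im_eq_zero_of_conjInv {J X : Matrix ι ι ℂ} (hJ : J * J = -1)
    (hX : conjInv J X = X) : X.trace.im = 0 := by
  rw [conjInv_apply] at hX
  have h := congrArg Complex.im (congrArg Matrix.trace hX)
  rw [Matrix.trace_neg, Matrix.trace_mul_comm, ← mul_assoc, hJ, neg_one_mul, Matrix.trace_neg,
    neg_neg, Matrix.trace_transpose, Matrix.trace_conjTranspose, Complex.star_def,
    Complex.conj_im] at h
  linarith

/-- The contribution of the involution `conjInv J` to the conformality operator vanishes. -/
theorem trace_quaternionic_eq_zero {J M p : Matrix ι ι ℂ} (hJt : Jᵀ = -J)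
    (hM : M * J * Mᵀ = 0) : (Jᵀ * (pᵀ * M) * Jᵀ * (pᵀ * M)ᵀ).trace = 0 := by
  have h : Jᵀ * (pᵀ * M) * Jᵀ * (pᵀ * M)ᵀ = J * pᵀ * (M * J * Mᵀ) * p := by
    rw [hJt, Matrix.transpose_mul, Matrix.transpose_transpose]
    simp only [neg_mul, mul_neg, neg_neg, mul_assoc]
  rw [h, hM, mul_zero, zero_mul, Matrix.trace_zero]

/-- The group `det x = 1` of real matrices: the Lie algebra is the orthogonal complement of `1`. -/
theorem isEigenfunction_specialLinear {M : Matrix ι ι ℂ} (hM : M * Mᵀ = 0) :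
    IsEigenfunction {x : Matrix ι ι ℝ | x.det = 1} (fun X => (M * (toC X)ᵀ).trace)
      (1 - 1 / Fintype.card ι) (-(1 / Fintype.card ι)) := by
  have hP := (isOrthProj_one (𝕜 := ℝ) (ι := ι)).sub_lineProj (D := 1) rfl
    (Or.inl Matrix.conjTranspose_one)
  have hfix : ∀ X : Matrix ι ι ℝ, ((1 : Module.End ℝ (Matrix ι ι ℝ)) - lineProj (1 : Matrix ι ι ℝ)) X = X
      ↔ X.trace = 0 := by
    intro X
    rw [hP.2, innerForm_one_left]
    exact ⟨fun h => h.2, fun h => ⟨rfl, h⟩⟩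
  refine isEigenfunction_trace_real (fun p hp => by rw [hp.out]; exact isUnit_one) hP.1
    (fun X hX => det_exp_of_trace_eq_zero ((hfix X).1 hX))
    (fun X hX => (hfix X).2 (trace_eq_zero_of_det_exp hX)) ?_ (fun p _ => ?_)
  · rw [map_sub, casimir_one_real, casimir_lineProj, innerForm_one_one]
    have h : toC (1 - (1 / (Fintype.card ι : ℝ)) • ((1 : Matrix ι ι ℝ) * 1))
        = (1 - 1 / (Fintype.card ι : ℂ)) • 1 := by
      rw [mul_one]
      ext i j
      by_cases hij : i = j
      · subst hij; simp [toC]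
      · simp [toC, hij]
    rw [h, Matrix.transpose_smul, Matrix.transpose_one, mul_smul_comm, mul_one]
  · rw [map_sub, squareSum_one_real, squareSum_lineProj, innerForm_one_one, traceFormReal_apply,
      toC_one, Matrix.transpose_one, mul_one, Matrix.trace_mul_comm _ M, Matrix.transpose_mul]
    have h : (toC p)ᵀ * M * (Mᵀ * (toC p)ᵀᵀ) = 0 := by
      rw [mul_assoc, ← mul_assoc M, hM, zero_mul, mul_zero]
    rw [h, Matrix.trace_zero, Complex.real_smul]
    push_cast
    ring

/-- The groups `x K xᵗ = K`, `det x = 1` with `K` orthogonal and symmetric or skew-symmetric. The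
hypothesis `hrank` holds for matrices `M` of rank one. -/
theorem isEigenfunction_orthogonal {K : Matrix ι ι ℝ} (hK : K * Kᵀ = 1) {ε : ℝ}
    (hε : ε = 1 ∨ ε = -1) (hKε : Kᵀ = ε • K) {M : Matrix ι ι ℂ} {δ : ℂ} (hδ : ε * δ ^ 2 = 1)
    (hMK : M * (toC K)ᵀ = δ • M) (hM : M * Mᵀ = 0)
    (hrank : ∀ p, (Mᵀ * p * (Mᵀ * p)).trace = (M * pᵀ).trace ^ 2) :
    IsEigenfunction {x : Matrix ι ι ℝ | x * K * xᵀ = K ∧ x.det = 1}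
      (fun X => (M * (toC X)ᵀ).trace) ((1 - (K.trace : ℂ) * δ) / 2) (-(1 / 2)) := by
  have hKH : Kᴴ = Kᵀ := Matrix.conjTranspose_eq_transpose_of_trivial K
  have hKK : K * Kᴴ = 1 := by rw [hKH, hK]
  have hinv : IsSymmInvolution (adjInv K) := adjInv_isSymmInvolution hKK (by
    rw [hKH, hKε]
    rcases hε with h | h
    · left; rw [h, one_smul]
    · right; rw [h, neg_one_smul])
  have hfix : ∀ X, fixProj (adjInv K) X = X
      ↔ ∀ t : ℝ, NormedSpace.exp (t • X) * K * (NormedSpace.exp (t • X))ᵀ = K := by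
    intro X
    rw [fixProj_eq_self, adjInv_eq_self hKK, ← exp_mul_mul_conjTranspose_iff]
    simp only [Matrix.conjTranspose_eq_transpose_of_trivial]
  refine isEigenfunction_trace_real (fun p hp => by rw [hp.2]; exact isUnit_one) hinv.isOrthProj
    (fun X hX => ?_) (fun X hX => (hfix X).2 fun t => (hX t).1) ?_ (fun p _ => ?_)
  · exact ⟨exp_mem_of_forall (p := fun Z => Z * K * Zᵀ = K) ((hfix X).1 hX),
      det_exp_of_trace_eq_zero (trace_re_eq_zero_of_adjInv hKK (fixProj_eq_self.1 hX))⟩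
  · rw [fixProj, map_smul, map_add, casimir_one_real, casimir_adjInv_real]
    have h : toC ((1 / 2 : ℝ) • (1 + -(K.trace • K)))
        = (1 / 2 : ℂ) • (1 - (K.trace : ℂ) • toC K) := by
      ext i j
      by_cases hij : i = j
      · subst hij; simp [toC]; ring
      · simp [toC, hij]
    rw [h, Matrix.transpose_smul, Matrix.transpose_sub, Matrix.transpose_one,
      Matrix.transpose_smul, mul_smul_comm, mul_sub, mul_one, mul_smul_comm, hMK]
    module
  · rw [fixProj, map_smul, map_add, squareSum_one_real, squareSum_adjInv_real]
    have h1 : (toC p)ᵀ * M * ((toC p)ᵀ * M)ᵀ = 0 := by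
      rw [Matrix.transpose_mul, mul_assoc, ← mul_assoc M, hM, zero_mul, mul_zero]
    have h2 : toC K * Mᵀ = δ • Mᵀ := by
      rw [← Matrix.transpose_smul, ← hMK, Matrix.transpose_mul, Matrix.transpose_transpose]
    have h3 : (toC K)ᵀ = (ε : ℂ) • toC K := by
      rw [← toC_transpose, hKε]
      ext i j
      simp [toC]
    have h4 : (toC K)ᵀ * ((toC p)ᵀ * M)ᵀ * toC K * ((toC p)ᵀ * M)ᵀ
        = (ε * δ ^ 2) • (Mᵀ * toC p * (Mᵀ * toC p)) := by
      rw [Matrix.transpose_mul, Matrix.transpose_transpose, h3, smul_mul_assoc, smul_mul_assoc,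
        smul_mul_assoc, ← mul_assoc (toC K), h2, mul_assoc _ (toC K), ← mul_assoc (toC K), h2]
      simp only [smul_mul_assoc, mul_smul_comm, smul_smul]
      congr 1
      ring
    rw [h1, h4, hδ, one_smul, hrank, Matrix.trace_zero, Complex.real_smul]
    push_cast
    ring

/-- The groups `z K z* = K`, `det z = 1` with `K` unitary and Hermitian. The condition on the
determinant removes the line spanned by `i` from the Lie algebra. -/
theorem isEigenfunction_specialUnitary {K : Matrix ι ι ℂ} (hK : K * K = 1) (hKH : Kᴴ = K)
    {M : Matrix ι ι ℂ} {δ : ℂ} (hδ : δ ^ 2 = 1) (hMK : M * Kᵀ = δ • M)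
    (hrank : ∀ p, (Mᵀ * p * (Mᵀ * p)).trace = (M * pᵀ).trace ^ 2) :
    IsEigenfunction {z : Matrix ι ι ℂ | z * K * zᴴ = K ∧ z.det = 1}
      (fun X => (M * Xᵀ).trace) (-(K.trace * δ) + 1 / Fintype.card ι)
      (-1 + 1 / Fintype.card ι) := by
  have hKK : K * Kᴴ = 1 := by rw [hKH, hK]
  have hinv : IsSymmInvolution (adjInv K) := adjInv_isSymmInvolution hKK (Or.inl hKH)
  have hD : fixProj (adjInv K) (Complex.I • 1) = Complex.I • 1 := by
    rw [fixProj_eq_self, adjInv_I_smul, adjInv_apply, Matrix.conjTranspose_one, mul_one, hKK,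
      smul_neg, neg_neg]
  have hP := hinv.isOrthProj.sub_lineProj hD (Or.inr (by
    rw [Matrix.conjTranspose_smul, Matrix.conjTranspose_one, Complex.star_def, Complex.conj_I,
      neg_smul]))
  have hfix : ∀ X, fixProj (adjInv K) X = X
      ↔ ∀ t : ℝ, NormedSpace.exp (t • X) * K * (NormedSpace.exp (t • X))ᴴ = K := by
    intro X
    rw [fixProj_eq_self, adjInv_eq_self hKK, ← exp_mul_mul_conjTranspose_iff]
  refine isEigenfunction_trace (fun p hp => by rw [hp.2]; exact isUnit_one) hP.1
    (fun X hX => ?_) (fun X hX => ?_) ?_ (fun p _ => ?_)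
  · rw [hP.2, innerForm_I_left] at hX
    exact ⟨exp_mem_of_forall (p := fun Z => Z * K * Zᴴ = K) ((hfix X).1 hX.1),
      det_exp_of_trace_eq_zero (Complex.ext
        (trace_re_eq_zero_of_adjInv hKK (fixProj_eq_self.1 hX.1)) hX.2)⟩
  · rw [hP.2, innerForm_I_left]
    refine ⟨(hfix X).2 fun t => (hX t).1, ?_⟩
    rw [trace_eq_zero_of_det_exp fun t => (hX t).2, Complex.zero_im]
  · rw [map_sub, fixProj, map_smul, map_add, casimir_of_linear (T := 1) (fun _ => rfl),
      casimir_adjInv, casimir_lineProj, innerForm_I_I, smul_mul_smul_comm, Complex.I_mul_I,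
      mul_one, hKH, zero_add]
    have h : (1 / 2 : ℝ) • -((2 : ℂ) • K.trace • K) - (1 / (Fintype.card ι : ℝ)) •
        (-1 : ℂ) • (1 : Matrix ι ι ℂ)
        = -(K.trace • K) + (1 / (Fintype.card ι : ℂ)) • (1 : Matrix ι ι ℂ) := by
      ext i j
      simp
    rw [h, Matrix.transpose_add, Matrix.transpose_neg, Matrix.transpose_smul,
      Matrix.transpose_smul, Matrix.transpose_one, mul_add, mul_neg, mul_smul_comm,
      mul_smul_comm, hMK, mul_one]
    module
  · rw [map_sub, fixProj, map_smul, map_add,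
      squareSum_of_linear (traceForm_I_smul _) (T := 1) (fun _ => rfl), squareSum_adjInv,
      squareSum_lineProj, innerForm_I_I, traceForm_I_smul, traceForm_apply, Matrix.transpose_one,
      mul_one, Matrix.trace_mul_comm _ M]
    have h2 : K * Mᵀ = δ • Mᵀ := by
      rw [← Matrix.transpose_smul, ← hMK, Matrix.transpose_mul, Matrix.transpose_transpose]
    have h4 : Kᴴ * (pᵀ * M)ᵀ * K * (pᵀ * M)ᵀ = (δ ^ 2) • (Mᵀ * p * (Mᵀ * p)) := by
      rw [Matrix.transpose_mul, Matrix.transpose_transpose, hKH, ← mul_assoc K, h2,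
        mul_assoc _ K, ← mul_assoc K, h2]
      simp only [smul_mul_assoc, mul_smul_comm, smul_smul]
      congr 1
      ring
    rw [h4, hδ, one_smul, hrank, mul_mul_mul_comm, Complex.I_mul_I]
    simp only [Complex.real_smul]
    push_cast
    ring

/-- The groups of matrices `q` with `q J = J q̄` and `q K q* = K`, where `J` is a quaternionic
structure and `K` is real, symmetric and orthogonal. The Lie algebra consists of traceless matrices,
so the condition `det q = 1` may or may not be imposed. -/
theorem isEigenfunction_quaternionic {J K : Matrix ι ι ℂ} (hJ : J * J = -1) (hJr : Jᴴᵀ = J)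
    (hJt : Jᵀ = -J) (hK : K * K = 1) (hKH : Kᴴ = K) (hKt : Kᵀ = K)
    (hJK : J * K = K * J ∨ J * K = -(K * J))
    {G : Set (Matrix ι ι ℂ)} (hG : ∀ q ∈ G, q * J = J * qᴴᵀ ∧ q * K * qᴴ = K)
    (hG' : ∀ q, q * J = J * qᴴᵀ → q * K * qᴴ = K → q.det = 1 → q ∈ G)
    {M : Matrix ι ι ℂ} {δ : ℂ} (hδ : δ ^ 2 = 1) (hMK : M * K = δ • M) (hM : M * J * Mᵀ = 0)
    (hrank : ∀ p, (Mᵀ * p * (Mᵀ * p)).trace = (M * pᵀ).trace ^ 2) :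
    IsEigenfunction G
      (fun X => (M * Xᵀ).trace) (-((1 + K.trace * δ) / 2)) (-(1 / 2)) := by
  have hKK : K * Kᴴ = 1 := by rw [hKH, hK]
  have hJh : Jᴴ = -J := by rw [← hJt, ← hJr, Matrix.transpose_transpose, hJr]
  have hθ : IsSymmInvolution (adjInv K) := adjInv_isSymmInvolution hKK (Or.inl hKH)
  have hσ : IsSymmInvolution (conjInv J) := conjInv_isSymmInvolution hJ hJr hJt
  have hcomm : ∀ X, adjInv K (conjInv J X) = conjInv J (adjInv K X) := by
    intro X
    have e : Xᴴᴴᵀ = Xᵀ := by rw [Matrix.conjTranspose_conjTranspose]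
    have e2 : Xᴴᵀᴴ = Xᴴᴴᵀ := rfl
    simp only [adjInv_apply, conjInv_apply, Matrix.conjTranspose_neg, Matrix.conjTranspose_mul,
      Matrix.transpose_neg, Matrix.transpose_mul, hJh, hKH, hKt, mul_neg, neg_mul, neg_neg, e2, e]
    rcases hJK with h | h
    · calc K * (J * (Xᵀ * J)) * K = (K * J) * Xᵀ * (J * K) := by simp only [mul_assoc]
        _ = (J * K) * Xᵀ * (K * J) := by rw [h]
        _ = _ := by simp only [mul_assoc]
    · calc K * (J * (Xᵀ * J)) * K = (K * J) * Xᵀ * (J * K) := by simp only [mul_assoc]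
        _ = (J * K) * Xᵀ * (K * J) := by rw [h, neg_mul, neg_mul, mul_neg]
        _ = _ := by simp only [mul_assoc]
  have hcomm' : ∀ X, fixProj (adjInv K) (fixProj (conjInv J) X)
      = fixProj (conjInv J) (fixProj (adjInv K) X) := by
    intro X
    simp only [fixProj_apply, map_smul, map_add, hcomm]
    module
  have hfix : ∀ X, (fixProj (adjInv K) * fixProj (conjInv J)) X = X
      ↔ (∀ t : ℝ, NormedSpace.exp (t • X) * J = J * (NormedSpace.exp (t • X))ᴴᵀ) ∧
        ∀ t : ℝ, NormedSpace.exp (t • X) * K * (NormedSpace.exp (t • X))ᴴ = K := by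
    intro X
    rw [hθ.isOrthProj.mul_eq_self hσ.isOrthProj hcomm', fixProj_eq_self, fixProj_eq_self,
      adjInv_eq_self hKK, conjInv_eq_self hJ, exp_mul_eq_mul_conj_iff,
      exp_mul_mul_conjTranspose_iff, and_comm]
  have hP : fixProj (adjInv K) * fixProj (conjInv J)
      = (1 / 4 : ℝ) • (1 + adjInv K + conjInv J + adjInv K * conjInv J) := by
    rw [fixProj, fixProj, smul_mul_smul_comm]
    congr 1
    · norm_num
    · noncomm_ring
  -- A product of two antilinear involutions is complex linear and contributes nothing.
  have hlin : ∀ Y, (adjInv K * conjInv J) (Complex.I • Y)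
      = Complex.I • (adjInv K * conjInv J) Y := by
    intro Y
    simp only [Module.End.mul_apply, conjInv_I_smul, map_neg, adjInv_I_smul, neg_neg]
  refine isEigenfunction_trace (fun p hp => ?_) (hθ.isOrthProj.mul hσ.isOrthProj hcomm')
    (fun X hX => ?_) (fun X hX => ?_) ?_ (fun p _ => ?_)
  · have h : p * (K * pᴴ * K) = 1 := by
      rw [← mul_assoc, ← mul_assoc, (hG p hp).2, hK]
    exact Matrix.isUnit_det_of_right_inverse h
  · have htr := trace_im_eq_zero_of_conjInv hJ
      (fixProj_eq_self.1 ((hθ.isOrthProj.mul_eq_self hσ.isOrthProj hcomm').1 hX).2)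
    have htr' := trace_re_eq_zero_of_adjInv hKK
      (fixProj_eq_self.1 ((hθ.isOrthProj.mul_eq_self hσ.isOrthProj hcomm').1 hX).1)
    rw [hfix] at hX
    exact hG' _ (exp_mem_of_forall (p := fun Z => Z * J = J * Zᴴᵀ) hX.1)
      (exp_mem_of_forall (p := fun Z => Z * K * Zᴴ = K) hX.2)
      (det_exp_of_trace_eq_zero (Complex.ext htr' htr))
  · rw [hfix]
    exact ⟨fun t => (hG _ (hX t)).1, fun t => (hG _ (hX t)).2⟩
  · rw [hP, map_smul, map_add, map_add, map_add, casimir_of_linear (T := 1) (fun _ => rfl),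
      casimir_adjInv, casimir_conjInv, casimir_of_linear hlin, hJt, mul_neg, hJ, neg_neg, hKH]
    have h : (1 / 4 : ℝ) • (0 + -((2 : ℂ) • K.trace • K) + -((2 : ℂ) • (1 : Matrix ι ι ℂ)) + 0)
        = -((1 / 2 : ℂ) • (K.trace • K + 1)) := by
      ext i j
      simp
      ring
    rw [h, Matrix.transpose_neg, Matrix.transpose_smul, Matrix.transpose_add,
      Matrix.transpose_smul, Matrix.transpose_one, hKt, mul_neg, mul_smul_comm, mul_add,
      mul_smul_comm, hMK, mul_one]
    module
  · rw [hP, map_smul, map_add, map_add, map_add,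
      squareSum_of_linear (traceForm_I_smul _) (T := 1) (fun _ => rfl), squareSum_adjInv,
      squareSum_conjInv, squareSum_of_linear (traceForm_I_smul _) hlin]
    have h2 : K * Mᵀ = δ • Mᵀ := by
      rw [← Matrix.transpose_smul, ← hMK, Matrix.transpose_mul, hKt]
    have h4 : Kᴴ * (pᵀ * M)ᵀ * K * (pᵀ * M)ᵀ = (δ ^ 2) • (Mᵀ * p * (Mᵀ * p)) := by
      rw [Matrix.transpose_mul, Matrix.transpose_transpose, hKH, ← mul_assoc K, h2,
        mul_assoc _ K, ← mul_assoc K, h2]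
      simp only [smul_mul_assoc, mul_smul_comm, smul_smul]
      congr 1
      ring
    rw [h4, hδ, one_smul, hrank, trace_quaternionic_eq_zero hJt hM]
    simp only [Complex.real_smul]
    push_cast
    ring

/-- The groups of matrices `q` with `q J = J q̄` and `det q = 1`, where `J` is a quaternionic
structure. -/
theorem isEigenfunction_quaternionicSpecialLinear {J : Matrix ι ι ℂ} (hJ : J * J = -1)
    (hJr : Jᴴᵀ = J) (hJt : Jᵀ = -J) {M : Matrix ι ι ℂ} (hM : M * J * Mᵀ = 0) :
    IsEigenfunction {q : Matrix ι ι ℂ | q * J = J * qᴴᵀ ∧ q.det = 1}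
      (fun X => (M * Xᵀ).trace) (-(1 + 1 / Fintype.card ι)) (-(1 / Fintype.card ι)) := by
  have hσ : IsSymmInvolution (conjInv J) := conjInv_isSymmInvolution hJ hJr hJt
  have hD : fixProj (conjInv J) 1 = 1 := by
    rw [fixProj_eq_self, conjInv_apply, Matrix.conjTranspose_one, Matrix.transpose_one, mul_one,
      hJ, neg_neg]
  have hP := hσ.isOrthProj.sub_lineProj hD (Or.inl Matrix.conjTranspose_one)
  have hfix : ∀ X, fixProj (conjInv J) X = X
      ↔ ∀ t : ℝ, NormedSpace.exp (t • X) * J = J * (NormedSpace.exp (t • X))ᴴᵀ := by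
    intro X
    rw [fixProj_eq_self, conjInv_eq_self hJ, exp_mul_eq_mul_conj_iff]
  refine isEigenfunction_trace (fun p hp => by rw [hp.2]; exact isUnit_one) hP.1
    (fun X hX => ?_) (fun X hX => ?_) ?_ (fun p _ => ?_)
  · rw [hP.2, innerForm_one_left] at hX
    exact ⟨exp_mem_of_forall (p := fun Z => Z * J = J * Zᴴᵀ) ((hfix X).1 hX.1),
      det_exp_of_trace_eq_zero (Complex.ext hX.2
        (trace_im_eq_zero_of_conjInv hJ (fixProj_eq_self.1 hX.1)))⟩
  · rw [hP.2, innerForm_one_left]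
    refine ⟨(hfix X).2 fun t => (hX t).1, ?_⟩
    rw [trace_eq_zero_of_det_exp fun t => (hX t).2, map_zero]
  · rw [map_sub, fixProj, map_smul, map_add, casimir_of_linear (T := 1) (fun _ => rfl),
      casimir_conjInv, casimir_lineProj, innerForm_one_one, hJt, mul_neg, hJ, neg_neg, mul_one]
    have h : (1 / 2 : ℝ) • (0 + -((2 : ℂ) • (1 : Matrix ι ι ℂ)))
        - (1 / (Fintype.card ι : ℝ)) • (1 : Matrix ι ι ℂ)
        = -((1 + 1 / (Fintype.card ι : ℂ)) • (1 : Matrix ι ι ℂ)) := by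
      ext i j
      simp
      ring
    rw [h, Matrix.transpose_neg, Matrix.transpose_smul, Matrix.transpose_one, mul_neg,
      mul_smul_comm, mul_one, neg_smul]
  · rw [map_sub, fixProj, map_smul, map_add,
      squareSum_of_linear (traceForm_I_smul _) (T := 1) (fun _ => rfl), squareSum_conjInv,
      squareSum_lineProj, innerForm_one_one, traceForm_apply, Matrix.transpose_one,
      mul_one, Matrix.trace_mul_comm _ M, trace_quaternionic_eq_zero hJt hM]
    simp only [Complex.real_smul]
    push_cast
    ring

end Families

/-! ### Rank-one matrices and block matrices -/

section Outer

variable {ι : Type*}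

theorem outer_eq (a v : ι → ℂ) : outer a v = Matrix.vecMulVec a v := rfl

theorem outer_elim_zero (a v u : ι → ℂ) :
    outer (Sum.elim a 0) (Sum.elim v u) = Matrix.fromBlocks (outer a v) (outer a u) 0 0 := by
  ext (i | i) (j | j) <;> simp [outer]

theorem outer_zero_elim (a v u : ι → ℂ) :
    outer (Sum.elim 0 a) (Sum.elim v u) = Matrix.fromBlocks 0 0 (outer a v) (outer a u) := by
  ext (i | i) (j | j) <;> simp [outer]

theorem outer_smul (a v : ι → ℂ) (c : ℂ) : outer a (c • v) = c • outer a v := by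
  ext i j
  simp [outer]
  ring

theorem outer_zero (a : ι → ℂ) : outer a 0 = 0 := by
  ext i j
  simp [outer]

end Outer

section RankOne

variable {ι : Type*} [Fintype ι]

/-- For a matrix `M` of rank one, `Mᵗ p` has rank one, and the trace of its square is the square of
its trace. -/
theorem trace_outer_sq (a v : ι → ℂ) (p : Matrix ι ι ℂ) :
    ((outer a v)ᵀ * p * ((outer a v)ᵀ * p)).trace = (outer a v * pᵀ).trace ^ 2 := by
  have h1 : (outer a v)ᵀ * p = Matrix.vecMulVec v (a ᵥ* p) := by
    rw [outer_eq, Matrix.transpose_vecMulVec, Matrix.vecMulVec_mul]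
  have h2 : (outer a v * pᵀ).trace = v ⬝ᵥ (a ᵥ* p) := by
    rw [← Matrix.trace_transpose, Matrix.transpose_mul, Matrix.transpose_transpose,
      Matrix.trace_mul_comm, h1, Matrix.trace_vecMulVec]
  rw [h1, h2, Matrix.vecMulVec_mul_vecMulVec, Matrix.vecMulVec_smul, Matrix.trace_smul,
    Matrix.trace_vecMulVec, smul_eq_mul, dotProduct_comm, sq]

theorem outer_mul_outer_transpose {a v : ι → ℂ} (hv : Isotropic v) :
    outer a v * (outer a v)ᵀ = 0 := by
  rw [outer_eq, Matrix.transpose_vecMulVec, Matrix.vecMulVec_mul_vecMulVec,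
    (show v ⬝ᵥ v = 0 from hv), zero_smul, Matrix.vecMulVec_zero]

theorem outer_mul_skew_mul_outer_transpose (a v : ι → ℂ) {J : Matrix ι ι ℂ} (hJ : Jᵀ = -J) :
    outer a v * J * (outer a v)ᵀ = 0 := by
  have h : (v ᵥ* J) ⬝ᵥ v = 0 := by
    have h1 : (v ᵥ* J) ⬝ᵥ v = -((v ᵥ* J) ⬝ᵥ v) := by
      conv_lhs => rw [← neg_neg J, ← hJ, Matrix.vecMul_neg, Matrix.vecMul_transpose,
        neg_dotProduct, dotProduct_comm, Matrix.dotProduct_mulVec]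
    exact self_eq_neg.1 h1
  rw [outer_eq, Matrix.vecMulVec_mul, Matrix.transpose_vecMulVec, Matrix.vecMulVec_mul_vecMulVec, h,
    zero_smul, Matrix.vecMulVec_zero]

theorem trace_fromBlocks_mul_transpose (A B C D : Matrix ι ι ℂ)
    (Q : Matrix (ι ⊕ ι) (ι ⊕ ι) ℂ) :
    (Matrix.fromBlocks A B C D * Qᵀ).trace
      = (A * Q.toBlocks₁₁ᵀ + B * Q.toBlocks₁₂ᵀ).trace
        + (C * Q.toBlocks₂₁ᵀ + D * Q.toBlocks₂₂ᵀ).trace := by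
  conv_lhs => rw [← Matrix.fromBlocks_toBlocks Q, Matrix.fromBlocks_transpose,
    Matrix.fromBlocks_multiply]
  simp [Matrix.trace, Fintype.sum_sum_type]

end RankOne

/-! ### The standard quaternionic structure -/

section Quaternion

variable {ι : Type*}

theorem quatRep_conjTranspose (x : Matrix ι ι ℍ[ℝ]) : quatRep xᴴ = (quatRep x)ᴴ := by
  rw [quatRep, quatRep, quatBlock, quatBlock, Matrix.fromBlocks_conjTranspose]
  congr 1
  all_goals
    ext i j
    apply Complex.ext <;> simp

theorem quatRep_injective : Function.Injective (quatRep (ι := ι)) := by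
  intro x y h
  rw [quatRep, quatRep, quatBlock, quatBlock, Matrix.fromBlocks_inj] at h
  obtain ⟨h1, h2, -, -⟩ := h
  ext i j
  · exact congrArg Complex.re (congrFun (congrFun h1 i) j)
  · exact congrArg Complex.im (congrFun (congrFun h1 i) j)
  · exact congrArg Complex.re (congrFun (congrFun h2 i) j)
  · exact congrArg Complex.im (congrFun (congrFun h2 i) j)

theorem exists_quatRep (z w : Matrix ι ι ℂ) : ∃ x, quatRep x = quatBlock z w :=
  ⟨Matrix.of fun i j => ⟨(z i j).re, (z i j).im, (w i j).re, (w i j).im⟩, rfl⟩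

theorem quatRep_mul [Fintype ι] (x y : Matrix ι ι ℍ[ℝ]) : quatRep (x * y) = quatRep x * quatRep y := by
  have hre : ∀ f : ι → ℍ[ℝ], (∑ k, f k).re = ∑ k, (f k).re := fun f =>
    map_sum (⟨⟨fun z : ℍ[ℝ] => z.re, rfl⟩, fun _ _ => rfl⟩ : ℍ[ℝ] →+ ℝ) f _
  have hi : ∀ f : ι → ℍ[ℝ], (∑ k, f k).imI = ∑ k, (f k).imI := fun f =>
    map_sum (⟨⟨fun z : ℍ[ℝ] => z.imI, rfl⟩, fun _ _ => rfl⟩ : ℍ[ℝ] →+ ℝ) f _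
  have hj : ∀ f : ι → ℍ[ℝ], (∑ k, f k).imJ = ∑ k, (f k).imJ := fun f =>
    map_sum (⟨⟨fun z : ℍ[ℝ] => z.imJ, rfl⟩, fun _ _ => rfl⟩ : ℍ[ℝ] →+ ℝ) f _
  have hk : ∀ f : ι → ℍ[ℝ], (∑ k, f k).imK = ∑ k, (f k).imK := fun f =>
    map_sum (⟨⟨fun z : ℍ[ℝ] => z.imK, rfl⟩, fun _ _ => rfl⟩ : ℍ[ℝ] →+ ℝ) f _
  rw [quatRep, quatRep, quatRep, quatBlock, quatBlock, quatBlock, Matrix.fromBlocks_multiply]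
  congr 1
  all_goals
    ext i j
    apply Complex.ext
    all_goals
      simp only [Matrix.map_apply, Matrix.mul_apply, Matrix.add_apply, Matrix.neg_apply, hre, hi,
        hj, hk, Complex.add_re, Complex.add_im, Complex.neg_re, Complex.neg_im, Complex.conj_re,
        Complex.conj_im, Complex.re_sum, Complex.im_sum, Complex.mul_re, Complex.mul_im,
        Quaternion.re_mul, Quaternion.imI_mul, Quaternion.imJ_mul, Quaternion.imK_mul,
        ← Finset.sum_add_distrib, ← Finset.sum_neg_distrib]
      exact Finset.sum_congr rfl fun k _ => by ring

/-- The standard quaternionic structure, with blocks `0, I, -I, 0`; for `ι = Fin n` it is `Jn ℂ n`. -/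
def quatJ (ι : Type*) [DecidableEq ι] : Matrix (ι ⊕ ι) (ι ⊕ ι) ℂ :=
  Matrix.fromBlocks 0 1 (-1) 0

variable [DecidableEq ι]

theorem quatJ_conj : (quatJ ι)ᴴᵀ = quatJ ι := by
  rw [quatJ, Matrix.fromBlocks_conjTranspose, Matrix.fromBlocks_transpose]
  simp

theorem quatJ_transpose : (quatJ ι)ᵀ = -quatJ ι := by
  rw [quatJ, Matrix.fromBlocks_transpose, Matrix.fromBlocks_neg]
  simp

variable [Fintype ι]

theorem quatJ_mul_self : quatJ ι * quatJ ι = -1 := by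
  rw [quatJ, Matrix.fromBlocks_multiply, ← Matrix.fromBlocks_one, Matrix.fromBlocks_neg]
  simp

/-- The matrices of the form `quatBlock z w` are those intertwined with their conjugate by the
quaternionic structure. -/
theorem mul_quatJ_eq_iff {Q : Matrix (ι ⊕ ι) (ι ⊕ ι) ℂ} :
    Q * quatJ ι = quatJ ι * Qᴴᵀ ↔ Q = quatBlock Q.toBlocks₁₁ Q.toBlocks₁₂ := by
  have hmap : ∀ z : Matrix ι ι ℂ, zᴴᵀ = z.map (starRingEnd ℂ) := fun _ => rfl
  have hmm : ∀ z : Matrix ι ι ℂ, (z.map (starRingEnd ℂ)).map (starRingEnd ℂ) = z := by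
    intro z; ext; simp
  have h1 : Q * quatJ ι = Matrix.fromBlocks (-Q.toBlocks₁₂) Q.toBlocks₁₁ (-Q.toBlocks₂₂)
      Q.toBlocks₂₁ := by
    conv_lhs => rw [← Matrix.fromBlocks_toBlocks Q, quatJ, Matrix.fromBlocks_multiply]
    simp
  have h2 : quatJ ι * Qᴴᵀ = Matrix.fromBlocks (Q.toBlocks₂₁.map (starRingEnd ℂ))
      (Q.toBlocks₂₂.map (starRingEnd ℂ)) (-Q.toBlocks₁₁.map (starRingEnd ℂ))
      (-Q.toBlocks₁₂.map (starRingEnd ℂ)) := by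
    conv_lhs => rw [← Matrix.fromBlocks_toBlocks Q, Matrix.fromBlocks_conjTranspose,
      Matrix.fromBlocks_transpose, quatJ, Matrix.fromBlocks_multiply]
    simp [hmap]
  rw [h1, h2, Matrix.fromBlocks_inj]
  constructor
  · rintro ⟨h3, h4, h5, h6⟩
    conv_lhs => rw [← Matrix.fromBlocks_toBlocks Q]
    rw [quatBlock, h6, ← neg_neg Q.toBlocks₂₂, h5, neg_neg]
  · intro h
    conv at h => lhs; rw [← Matrix.fromBlocks_toBlocks Q]
    rw [quatBlock, Matrix.fromBlocks_inj] at h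
    obtain ⟨-, -, h5, h6⟩ := h
    rw [h5, h6]
    have hneg : ∀ z : Matrix ι ι ℂ, (-z).map (starRingEnd ℂ) = -z.map (starRingEnd ℂ) := by
      intro z; ext; simp
    rw [hneg, hmm, hmm]
    exact ⟨rfl, rfl, rfl, rfl⟩

theorem quatBlock_mul_quatJ (z w : Matrix ι ι ℂ) :
    quatBlock z w * quatJ ι = quatJ ι * (quatBlock z w)ᴴᵀ := by
  rw [mul_quatJ_eq_iff]
  rfl

/-- The quaternionic unitary groups, described inside the complex matrices. -/
theorem image_quatRep (D : Matrix ι ι ℍ[ℝ]) :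
    quatRep '' {x | x * D * xᴴ = D}
      = {q | q * quatJ ι = quatJ ι * qᴴᵀ ∧ q * quatRep D * qᴴ = quatRep D} := by
  ext q
  constructor
  · rintro ⟨x, hx, rfl⟩
    refine ⟨quatBlock_mul_quatJ _ _, ?_⟩
    rw [← quatRep_conjTranspose, ← quatRep_mul, ← quatRep_mul]
    exact congrArg quatRep hx
  · rintro ⟨h1, h2⟩
    obtain ⟨x, hx⟩ := exists_quatRep q.toBlocks₁₁ q.toBlocks₁₂
    rw [← mul_quatJ_eq_iff.1 h1] at hx
    subst hx
    refine ⟨x, quatRep_injective ?_, rfl⟩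
    rw [quatRep_mul, quatRep_mul, quatRep_conjTranspose]
    exact h2

end Quaternion

/-! ### The matrix `Ipq` -/

section Signature

variable (p q : ℕ)

theorem Ipq_mul_self (R : Type*) [Ring R] : Ipq R p q * Ipq R p q = 1 := by
  rw [Ipq, Matrix.fromBlocks_multiply, ← Matrix.fromBlocks_one]
  simp

theorem Ipq_transpose (R : Type*) [Ring R] : (Ipq R p q)ᵀ = Ipq R p q := by
  rw [Ipq, Matrix.fromBlocks_transpose]
  simp

theorem Ipq_conjTranspose : (Ipq ℂ p q)ᴴ = Ipq ℂ p q := by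
  rw [Ipq, Matrix.fromBlocks_conjTranspose]
  simp

theorem trace_Ipq (R : Type*) [Ring R] : (Ipq R p q).trace = (q : R) - p := by
  simp [Ipq, Matrix.trace, Fintype.sum_sum_type]
  abel

theorem toC_Ipq : toC (Ipq ℝ p q) = Ipq ℂ p q := by
  ext (i | i) (j | j)
  · by_cases h : i = j <;> simp [toC, Ipq, h]
  · simp [toC, Ipq]
  · simp [toC, Ipq]
  · by_cases h : i = j <;> simp [toC, Ipq, h]

theorem quatRep_Ipq :
    quatRep (Ipq ℍ[ℝ] p q) = Matrix.fromBlocks (Ipq ℂ p q) 0 0 (Ipq ℂ p q) := by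
  rw [quatRep, quatBlock]
  congr 1
  all_goals
    ext (i | i) (j | j)
    · by_cases h : i = j <;> apply Complex.ext <;> simp [Ipq, h]
    · apply Complex.ext <;> simp [Ipq]
    · apply Complex.ext <;> simp [Ipq]
    · by_cases h : i = j <;> apply Complex.ext <;> simp [Ipq, h]

variable {p q}

theorem outer_mul_Ipq_of_C1 {a v : Fin p ⊕ Fin q → ℂ} (hv : v ∈ C1 p q) :
    outer a v * Ipq ℂ p q = (-1 : ℂ) • outer a v := by
  have h : v ᵥ* Ipq ℂ p q = (-1 : ℂ) • v := by
    ext (j | j)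
    · simp [Matrix.vecMul, dotProduct, Fintype.sum_sum_type, Ipq, Matrix.one_apply]
    · simp [Matrix.vecMul, dotProduct, Fintype.sum_sum_type, Ipq, hv j, Matrix.one_apply]
  rw [outer_eq, Matrix.vecMulVec_mul, h, Matrix.vecMulVec_smul]

theorem outer_mul_Ipq_of_C2 {a v : Fin p ⊕ Fin q → ℂ} (hv : v ∈ C2 p q) :
    outer a v * Ipq ℂ p q = (1 : ℂ) • outer a v := by
  have h : v ᵥ* Ipq ℂ p q = v := by
    ext (j | j)
    · simp [Matrix.vecMul, dotProduct, Fintype.sum_sum_type, Ipq, hv j, Matrix.one_apply]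
    · simp [Matrix.vecMul, dotProduct, Fintype.sum_sum_type, Ipq, Matrix.one_apply]
  rw [outer_eq, Matrix.vecMulVec_mul, h, one_smul]

end Signature

/-! ### The classical groups -/

section Groups

/-- Constants that involve division by the size of the matrices need to be compared only for nonzero
size: on matrices of size zero every trace function vanishes. -/
theorem IsEigenfunction.congr {𝕜 ι : Type*} [RCLike 𝕜] [Fintype ι] [DecidableEq ι]
    {G : Set (Matrix ι ι 𝕜)} {M : Matrix ι ι 𝕜 → Matrix ι ι ℂ} {lam mu lam' mu' : ℂ}
    (h : IsEigenfunction G (fun p => (M p).trace) lam mu)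
    (hc : Fintype.card ι ≠ 0 → lam = lam' ∧ mu = mu') :
    IsEigenfunction G (fun p => (M p).trace) lam' mu' := by
  by_cases hι : Fintype.card ι = 0
  · have := Fintype.card_eq_zero_iff.1 hι
    intro p hp
    have h0 : (M p).trace = 0 := by simp [Matrix.trace]
    have hp' := h p hp
    simp only [h0] at hp' ⊢
    simpa using hp'
  · obtain ⟨rfl, rfl⟩ := hc hι
    exact h

theorem isEigenfunction_SLR (n : ℕ) {A : Matrix (Fin n) (Fin n) ℂ} (hA : A * Aᵀ = 0) :
    IsEigenfunction (SLR n) (fun x => (A * (toC x)ᵀ).trace)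
      (((n : ℂ) - 1) / n) (-(1 / (n : ℂ))) := by
  refine (isEigenfunction_specialLinear hA).congr fun h => ?_
  rw [Fintype.card_fin] at h ⊢
  have hn : (n : ℂ) ≠ 0 := Nat.cast_ne_zero.2 h
  exact ⟨by field_simp, rfl⟩

theorem isEigenfunction_SO (n : ℕ) (a : Fin n → ℂ) {v : Fin n → ℂ} (hv : Isotropic v) :
    IsEigenfunction (SO n) (fun x => (outer a v * (toC x)ᵀ).trace)
      (-(((n : ℂ) - 1) / 2)) (-(1 / 2)) := by
  have hG : SO n = {x | x * 1 * xᵀ = 1 ∧ x.det = 1} := by simp only [mul_one]; rfl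
  rw [hG]
  convert isEigenfunction_orthogonal (K := 1) (ε := 1) (δ := 1) (by simp) (Or.inl rfl) (by simp)
    (by simp) (by simp [toC_one]) (outer_mul_outer_transpose hv) (trace_outer_sq a v) using 1
  rw [Matrix.trace_one, Fintype.card_fin]
  push_cast
  ring

theorem isEigenfunction_SU (n : ℕ) (a v : Fin n → ℂ) :
    IsEigenfunction (SU n) (fun z => (outer a v * zᵀ).trace)
      (-(((n : ℂ) ^ 2 - 1) / n)) (-(((n : ℂ) - 1) / n)) := by
  have hG : SU n = {x | x * 1 * xᴴ = 1 ∧ x.det = 1} := by simp only [mul_one]; rfl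
  rw [hG]
  refine (isEigenfunction_specialUnitary (δ := 1) (by simp) (by simp) (by simp) (by simp)
    (trace_outer_sq a v)).congr fun h => ?_
  rw [Matrix.trace_one, Fintype.card_fin]
  rw [Fintype.card_fin] at h
  have hn : (n : ℂ) ≠ 0 := Nat.cast_ne_zero.2 h
  constructor
  · field_simp
    ring
  · field_simp
    ring

theorem isEigenfunction_SOpq {p q : ℕ} (a : Fin p ⊕ Fin q → ℂ) {v : Fin p ⊕ Fin q → ℂ}
    {δ : ℂ} (hδ : δ ^ 2 = 1) (hv : outer a v * Ipq ℂ p q = δ • outer a v) (hiso : Isotropic v) :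
    IsEigenfunction (SOpq p q) (fun x => (outer a v * (toC x)ᵀ).trace)
      ((1 - ((q : ℂ) - p) * δ) / 2) (-(1 / 2)) := by
  have h := isEigenfunction_orthogonal (K := Ipq ℝ p q) (ε := 1) (δ := δ)
    (by rw [Ipq_transpose, Ipq_mul_self]) (Or.inl rfl) (by rw [Ipq_transpose, one_smul])
    (by simpa using hδ) (by rw [← toC_transpose, Ipq_transpose, toC_Ipq, hv])
    (outer_mul_outer_transpose hiso) (trace_outer_sq a v)
  rw [trace_Ipq] at h
  push_cast at h
  exact h

theorem isEigenfunction_SUpq {p q : ℕ} (a : Fin p ⊕ Fin q → ℂ) {v : Fin p ⊕ Fin q → ℂ}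
    {δ : ℂ} (hδ : δ ^ 2 = 1) (hv : outer a v * Ipq ℂ p q = δ • outer a v) {lam : ℂ}
    (hlam : (p : ℂ) + q ≠ 0 → -(((q : ℂ) - p) * δ) + 1 / ((p : ℂ) + q) = lam) :
    IsEigenfunction (SUpq p q) (fun z => (outer a v * zᵀ).trace)
      lam (-(((p : ℂ) + q - 1) / ((p : ℂ) + q))) := by
  refine (isEigenfunction_specialUnitary (K := Ipq ℂ p q) (δ := δ) (Ipq_mul_self p q ℂ)
    (Ipq_conjTranspose p q) hδ (by rw [Ipq_transpose, hv]) (trace_outer_sq a v)).congr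
    fun h => ?_
  rw [trace_Ipq, Fintype.card_sum, Fintype.card_fin, Fintype.card_fin]
  rw [Fintype.card_sum, Fintype.card_fin, Fintype.card_fin] at h
  have hn : (p : ℂ) + q ≠ 0 := by exact_mod_cast h
  push_cast
  refine ⟨hlam hn, ?_⟩
  field_simp
  ring

section Symplectic

variable {ι : Type*} [Fintype ι] [DecidableEq ι]

/-- The groups `{x | x D x* = D}` of quaternionic matrices, where `D` is represented by
`diag(K, K)` with a real symmetric involution `K`. -/
theorem isEigenfunction_image_quatRep {D : Matrix ι ι ℍ[ℝ]} {K : Matrix ι ι ℂ}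
    (hD : quatRep D = Matrix.fromBlocks K 0 0 K) (hK : K * K = 1) (hKH : Kᴴ = K) (hKt : Kᵀ = K)
    (a : ι → ℂ) {v u : ι → ℂ} {δ : ℂ} (hδ : δ ^ 2 = 1) (hv : outer a v * K = δ • outer a v)
    (hu : outer a u * K = δ • outer a u) :
    IsEigenfunction (quatRep '' {x | x * D * xᴴ = D})
      (fun q => (outer a v * q.toBlocks₁₁ᵀ + outer a u * q.toBlocks₁₂ᵀ).trace)
      (-((1 + 2 * K.trace * δ) / 2)) (-(1 / 2)) := by
  have h := isEigenfunction_quaternionic (J := quatJ ι) (K := Matrix.fromBlocks K 0 0 K)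
    (M := outer (Sum.elim a 0) (Sum.elim v u)) (δ := δ)
    (G := quatRep '' {x | x * D * xᴴ = D})
    quatJ_mul_self quatJ_conj quatJ_transpose
    (by simp [Matrix.fromBlocks_multiply, hK])
    (by simp [Matrix.fromBlocks_conjTranspose, hKH])
    (by simp [Matrix.fromBlocks_transpose, hKt])
    (Or.inl (by simp [quatJ, Matrix.fromBlocks_multiply]))
    (fun q hq => by rw [image_quatRep, hD] at hq; exact hq)
    (fun q h1 h2 _ => by rw [image_quatRep, hD]; exact ⟨h1, h2⟩)
    hδ (by simp [outer_elim_zero, Matrix.fromBlocks_multiply, hv, hu, Matrix.fromBlocks_smul])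
    (outer_mul_skew_mul_outer_transpose _ _ quatJ_transpose) (trace_outer_sq _ _)
  have htr : (Matrix.fromBlocks K 0 0 K).trace = 2 * K.trace := by
    simp [Matrix.trace, Fintype.sum_sum_type, two_mul]
  simpa only [htr, outer_elim_zero, trace_fromBlocks_mul_transpose, zero_mul, add_zero,
    Matrix.trace_zero] using h

end Symplectic

theorem isEigenfunction_Sp (n : ℕ) (a v u : Fin n → ℂ) :
    IsEigenfunction (Sp n)
      (fun q => (outer a v * q.toBlocks₁₁ᵀ + outer a u * q.toBlocks₁₂ᵀ).trace)
      (-((2 * (n : ℂ) + 1) / 2)) (-(1 / 2)) := by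
  have hG : Sp n = quatRep '' {x : Matrix (Fin n) (Fin n) ℍ[ℝ] | x * 1 * xᴴ = 1} := by
    simp only [mul_one]; rfl
  have hone : quatRep (1 : Matrix (Fin n) (Fin n) ℍ[ℝ]) = Matrix.fromBlocks 1 0 0 1 := by
    rw [quatRep, quatBlock]
    congr 1
    all_goals
      ext i j
      by_cases h : i = j <;> apply Complex.ext <;> simp [Matrix.one_apply, h]
  rw [hG]
  convert isEigenfunction_image_quatRep (K := 1) (δ := 1) hone (by simp) (by simp) (by simp) a
    (v := v) (u := u) (by simp) (by simp) (by simp) using 1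
  rw [Matrix.trace_one, Fintype.card_fin]
  ring

theorem isEigenfunction_Sppq {p q : ℕ} (a : Fin p ⊕ Fin q → ℂ) {v u : Fin p ⊕ Fin q → ℂ}
    {δ : ℂ} (hδ : δ ^ 2 = 1) (hv : outer a v * Ipq ℂ p q = δ • outer a v)
    (hu : outer a u * Ipq ℂ p q = δ • outer a u) :
    IsEigenfunction (Sppq p q)
      (fun x => (outer a v * x.toBlocks₁₁ᵀ + outer a u * x.toBlocks₁₂ᵀ).trace)
      (-((1 + 2 * ((q : ℂ) - p) * δ) / 2)) (-(1 / 2)) := by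
  have h := isEigenfunction_image_quatRep (quatRep_Ipq p q) (Ipq_mul_self p q ℂ)
    (Ipq_conjTranspose p q) (Ipq_transpose p q ℂ) a hδ hv hu
  rw [trace_Ipq] at h
  exact h

/-- The row vector `(v, iv)` is isotropic, and it is an eigenvector of `J_n` for an eigenvalue of
square `-1`, as the skew-symmetry of `J_n` requires. Both functions on `Sp(n, ℝ)` in the theorem are
of the form considered here. -/
theorem isEigenfunction_SpR (n : ℕ) {a : Fin n ⊕ Fin n → ℂ} (v : Fin n → ℂ) :
    IsEigenfunction (SpR n)
      (fun q => (outer a (Sum.elim v (Complex.I • v)) * (toC q)ᵀ).trace) (1 / 2) (-(1 / 2)) := by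
  have hG : SpR n = {q | q * Jn ℝ n * qᵀ = Jn ℝ n ∧ q.det = 1} := by
    ext q
    exact and_comm
  have htr : (Jn ℝ n).trace = 0 := by simp [Jn, Matrix.trace, Fintype.sum_sum_type]
  have hJt : (Jn ℝ n)ᵀ = (-1 : ℝ) • Jn ℝ n := by
    rw [Jn, Matrix.fromBlocks_transpose, Matrix.fromBlocks_smul]
    simp
  have hJJ : Jn ℝ n * Jn ℝ n = -1 := by
    rw [Jn, Matrix.fromBlocks_multiply, ← Matrix.fromBlocks_one, Matrix.fromBlocks_neg]
    simp
  have hiso : Isotropic (Sum.elim v (Complex.I • v)) := by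
    have hI : ∀ x : ℂ, Complex.I * x * (Complex.I * x) = -(x * x) := fun x => by
      rw [mul_mul_mul_comm, Complex.I_mul_I, neg_one_mul]
    simp [Isotropic, dotProduct, Fintype.sum_sum_type, hI]
  have hvJ : Sum.elim v (Complex.I • v) ᵥ* (toC (Jn ℝ n))ᵀ
      = Complex.I • Sum.elim v (Complex.I • v) := by
    have hJ : (toC (Jn ℝ n))ᵀ = Matrix.fromBlocks 0 (-1) 1 0 := by
      rw [toC, Jn, Matrix.fromBlocks_map, Matrix.fromBlocks_transpose]
      congr 1
      all_goals
        ext i j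
        by_cases h : i = j <;> simp [h, Matrix.one_apply, eq_comm]
    rw [hJ, Matrix.vecMul_fromBlocks]
    ext (i | i)
    · simp
    · simp [Matrix.vecMul_neg, ← mul_assoc]
  rw [hG]
  convert isEigenfunction_orthogonal (K := Jn ℝ n) (ε := -1) (δ := Complex.I)
    (M := outer a (Sum.elim v (Complex.I • v)))
    (by rw [hJt, mul_smul_comm, hJJ, neg_one_smul, neg_neg]) (Or.inr rfl) hJt
    (by simp) (by rw [outer_eq, Matrix.vecMulVec_mul, hvJ, Matrix.vecMulVec_smul])
    (outer_mul_outer_transpose hiso) (trace_outer_sq _ _) using 1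
  rw [htr]
  simp

/-- On `SU(n, n)` the equation that defines `SO*(2n)` says that `J_n` intertwines `q` with its
conjugate; here `J_n` anticommutes with `I_{n,n}`. -/
theorem isEigenfunction_SOStar (n : ℕ) (a : Fin n ⊕ Fin n → ℂ) {v : Fin n ⊕ Fin n → ℂ}
    {δ : ℂ} (hδ : δ ^ 2 = 1) (hv : outer a v * Ipq ℂ n n = δ • outer a v) :
    IsEigenfunction (SOStar n) (fun q => (outer a v * qᵀ).trace) (-(1 / 2)) (-(1 / 2)) := by
  have hKK := Ipq_mul_self n n ℂ
  have hJK : Jn ℂ n * Ipq ℂ n n = -(Ipq ℂ n n * Jn ℂ n) := by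
    rw [Jn, Ipq, Matrix.fromBlocks_multiply, Matrix.fromBlocks_multiply, Matrix.fromBlocks_neg]
    simp
  have hJJ : Jn ℂ n * Jn ℂ n = -1 := quatJ_mul_self
  have hJt : (Jn ℂ n)ᵀ = -Jn ℂ n := quatJ_transpose
  -- For `q` with `q K q* = K`, the equation `q (K J) qᵗ = K J` says `J qᵗ = q* J`.
  have key : ∀ q : Matrix (Fin n ⊕ Fin n) (Fin n ⊕ Fin n) ℂ, q * Ipq ℂ n n * qᴴ = Ipq ℂ n n →
      (q * Jn ℂ n = Jn ℂ n * qᴴᵀ ↔ q * (Ipq ℂ n n * Jn ℂ n) * qᵀ = Ipq ℂ n n * Jn ℂ n) := by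
    intro q hq
    have hinv : (Ipq ℂ n n * qᴴ * Ipq ℂ n n) * q = 1 := by
      rw [mul_eq_one_comm, ← mul_assoc, ← mul_assoc, hq, hKK]
    have hT : q * Jn ℂ n = Jn ℂ n * qᴴᵀ ↔ Jn ℂ n * qᵀ = qᴴ * Jn ℂ n := by
      rw [← Matrix.transpose_inj, Matrix.transpose_mul, Matrix.transpose_mul,
        Matrix.transpose_transpose, hJt, neg_mul, mul_neg, neg_inj]
    rw [hT]
    constructor
    · intro h
      calc q * (Ipq ℂ n n * Jn ℂ n) * qᵀ = q * Ipq ℂ n n * (Jn ℂ n * qᵀ) := by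
            simp only [mul_assoc]
        _ = Ipq ℂ n n * Jn ℂ n := by rw [h, ← mul_assoc, hq]
    · intro h
      calc Jn ℂ n * qᵀ
          = Ipq ℂ n n * (Ipq ℂ n n * qᴴ * Ipq ℂ n n * q) * (Ipq ℂ n n * Jn ℂ n) * qᵀ := by
            rw [hinv, mul_one, ← mul_assoc, hKK, one_mul]
        _ = (Ipq ℂ n n * Ipq ℂ n n) * qᴴ * Ipq ℂ n n * (q * (Ipq ℂ n n * Jn ℂ n) * qᵀ) := by
            simp only [mul_assoc]
        _ = (Ipq ℂ n n * Ipq ℂ n n) * qᴴ * (Ipq ℂ n n * Ipq ℂ n n) * Jn ℂ n := by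
            rw [h]; simp only [mul_assoc]
        _ = qᴴ * Jn ℂ n := by rw [hKK, one_mul, mul_one]
  have h := isEigenfunction_quaternionic (J := Jn ℂ n) (K := Ipq ℂ n n) (G := SOStar n)
    (M := outer a v) hJJ quatJ_conj hJt hKK (Ipq_conjTranspose n n) (Ipq_transpose n n ℂ)
    (Or.inr hJK) (fun q hq => ⟨(key q hq.1.1).2 hq.2, hq.1.1⟩)
    (fun q h1 h2 h3 => ⟨⟨h2, h3⟩, (key q h2).1 h1⟩) hδ hv
    (outer_mul_skew_mul_outer_transpose a v hJt) (trace_outer_sq a v)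
  rw [trace_Ipq, sub_self, zero_mul, add_zero] at h
  exact h

theorem isEigenfunction_SUStar (n : ℕ) {A B : Matrix (Fin n) (Fin n) ℂ} (hAB : A * Bᵀ = B * Aᵀ) :
    IsEigenfunction (SUStar n)
      (fun q => (A * q.toBlocks₁₁ᵀ + B * q.toBlocks₁₂ᵀ).trace)
      (-((2 * (n : ℂ) + 1) / (2 * n))) (-(1 / (2 * (n : ℂ)))) := by
  have hG : SUStar n = {q | q * quatJ (Fin n) = quatJ (Fin n) * qᴴᵀ ∧ q.det = 1} := by
    ext q
    refine and_congr_left fun _ => ⟨?_, fun h => ⟨_, _, mul_quatJ_eq_iff.1 h⟩⟩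
    rintro ⟨z, w, rfl⟩
    exact quatBlock_mul_quatJ z w
  have hM : ∀ M : Matrix (Fin n ⊕ Fin n) (Fin n ⊕ Fin n) ℂ, M = Matrix.fromBlocks A B 0 0 →
      M * quatJ (Fin n) * Mᵀ = 0 := by
    rintro _ rfl
    simp [quatJ, Matrix.fromBlocks_multiply, Matrix.fromBlocks_transpose, hAB]
  have h := (isEigenfunction_quaternionicSpecialLinear quatJ_mul_self quatJ_conj quatJ_transpose
    (hM _ rfl)).congr (lam' := -((2 * (n : ℂ) + 1) / (2 * n))) (mu' := -(1 / (2 * (n : ℂ)))) (by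
      rw [Fintype.card_sum, Fintype.card_fin]
      intro h
      have hn : (n : ℂ) ≠ 0 := by
        rintro h0
        exact h (by simp [Nat.cast_eq_zero.1 h0])
      push_cast
      constructor
      · field_simp
        ring
      · field_simp
        ring)
  rw [hG]
  simpa only [trace_fromBlocks_mul_transpose, zero_mul, add_zero, Matrix.trace_zero] using h

end Groups

end

end EigenLie

theorem mainTheorem2 :
    -- SL(n, ℝ)
    (∀ (n : ℕ) (A : Matrix (Fin n) (Fin n) ℂ), A * A.transpose = 0 →
      EigenLie.IsEigenfunction (EigenLie.SLR n)
        (fun x => (A * (EigenLie.toC x).transpose).trace)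
        (((n : ℂ) - 1) / n) (-(1 / (n : ℂ)))) ∧
    -- SO(n)
    (∀ (n : ℕ) (a v : Fin n → ℂ), EigenLie.Isotropic v →
      EigenLie.IsEigenfunction (EigenLie.SO n)
        (fun x => (EigenLie.outer a v * (EigenLie.toC x).transpose).trace)
        (-(((n : ℂ) - 1) / 2)) (-(1 / 2))) ∧
    -- SU(n)
    (∀ (n : ℕ) (a v : Fin n → ℂ),
      EigenLie.IsEigenfunction (EigenLie.SU n)
        (fun z => (EigenLie.outer a v * z.transpose).trace)
        (-(((n : ℂ) ^ 2 - 1) / n)) (-(((n : ℂ) - 1) / n))) ∧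
    -- Sp(n)
    (∀ (n : ℕ) (a v u : Fin n → ℂ),
      EigenLie.IsEigenfunction (EigenLie.Sp n)
        (fun q => (EigenLie.outer a v * q.toBlocks₁₁.transpose
          + EigenLie.outer a u * q.toBlocks₁₂.transpose).trace)
        (-((2 * (n : ℂ) + 1) / 2)) (-(1 / 2))) ∧
    -- SO(p, q)
    (∀ (p q : ℕ) (a v : Fin p ⊕ Fin q → ℂ), v ∈ EigenLie.C1 p q → EigenLie.Isotropic v →
      EigenLie.IsEigenfunction (EigenLie.SOpq p q)
        (fun x => (EigenLie.outer a v * (EigenLie.toC x).transpose).trace)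
        (((q : ℂ) - p + 1) / 2) (-(1 / 2))) ∧
    (∀ (p q : ℕ) (a v : Fin p ⊕ Fin q → ℂ), v ∈ EigenLie.C2 p q → EigenLie.Isotropic v →
      EigenLie.IsEigenfunction (EigenLie.SOpq p q)
        (fun x => (EigenLie.outer a v * (EigenLie.toC x).transpose).trace)
        (((p : ℂ) - q + 1) / 2) (-(1 / 2))) ∧
    -- SU(p, q)
    (∀ (p q : ℕ) (a v : Fin p ⊕ Fin q → ℂ), v ∈ EigenLie.C1 p q →
      EigenLie.IsEigenfunction (EigenLie.SUpq p q)
        (fun z => (EigenLie.outer a v * z.transpose).trace)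
        (((q : ℂ) ^ 2 - (p : ℂ) ^ 2 + 1) / ((p : ℂ) + q))
        (-(((p : ℂ) + q - 1) / ((p : ℂ) + q)))) ∧
    (∀ (p q : ℕ) (a v : Fin p ⊕ Fin q → ℂ), v ∈ EigenLie.C2 p q →
      EigenLie.IsEigenfunction (EigenLie.SUpq p q)
        (fun z => (EigenLie.outer a v * z.transpose).trace)
        (((p : ℂ) ^ 2 - (q : ℂ) ^ 2 + 1) / ((p : ℂ) + q))
        (-(((p : ℂ) + q - 1) / ((p : ℂ) + q)))) ∧
    -- Sp(p, q)
    (∀ (p q : ℕ) (a v u : Fin p ⊕ Fin q → ℂ), v ∈ EigenLie.C1 p q → u ∈ EigenLie.C1 p q →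
      EigenLie.IsEigenfunction (EigenLie.Sppq p q)
        (fun x => (EigenLie.outer a v * x.toBlocks₁₁.transpose
          + EigenLie.outer a u * x.toBlocks₁₂.transpose).trace)
        (-((2 * ((p : ℂ) - q) + 1) / 2)) (-(1 / 2))) ∧
    (∀ (p q : ℕ) (a v u : Fin p ⊕ Fin q → ℂ), v ∈ EigenLie.C2 p q → u ∈ EigenLie.C2 p q →
      EigenLie.IsEigenfunction (EigenLie.Sppq p q)
        (fun x => (EigenLie.outer a v * x.toBlocks₁₁.transpose
          + EigenLie.outer a u * x.toBlocks₁₂.transpose).trace)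
        (-((2 * ((q : ℂ) - p) + 1) / 2)) (-(1 / 2))) ∧
    -- Sp(n, ℝ)
    (∀ (n : ℕ) (a v : Fin n → ℂ),
      EigenLie.IsEigenfunction (EigenLie.SpR n)
        (fun q => (EigenLie.outer a v * (EigenLie.toC q.toBlocks₁₁
          + Complex.I • EigenLie.toC q.toBlocks₁₂).transpose).trace)
        (1 / 2) (-(1 / 2))) ∧
    (∀ (n : ℕ) (a v : Fin n → ℂ),
      EigenLie.IsEigenfunction (EigenLie.SpR n)
        (fun q => (EigenLie.outer a v * (EigenLie.toC q.toBlocks₂₁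
          + Complex.I • EigenLie.toC q.toBlocks₂₂).transpose).trace)
        (1 / 2) (-(1 / 2))) ∧
    -- SO*(2n)
    (∀ (n : ℕ) (a v : Fin n → ℂ),
      EigenLie.IsEigenfunction (EigenLie.SOStar n)
        (fun q => (EigenLie.outer a v * q.toBlocks₁₁.transpose).trace)
        (-(1 / 2)) (-(1 / 2))) ∧
    (∀ (n : ℕ) (a v : Fin n → ℂ),
      EigenLie.IsEigenfunction (EigenLie.SOStar n)
        (fun q => (EigenLie.outer a v * q.toBlocks₁₂.transpose).trace)
        (-(1 / 2)) (-(1 / 2))) ∧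
    -- SU*(2n)
    (∀ (n : ℕ) (A B : Matrix (Fin n) (Fin n) ℂ), A * B.transpose = B * A.transpose →
      EigenLie.IsEigenfunction (EigenLie.SUStar n)
        (fun q => (A * q.toBlocks₁₁.transpose + B * q.toBlocks₁₂.transpose).trace)
        (-((2 * (n : ℂ) + 1) / (2 * n))) (-(1 / (2 * (n : ℂ))))) := by
  open EigenLie in
  refine ⟨fun n A hA => isEigenfunction_SLR n hA, fun n a v hv => isEigenfunction_SO n a hv,
    isEigenfunction_SU, isEigenfunction_Sp, fun p q a v hv hiso => ?_, fun p q a v hv hiso => ?_,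
    fun p q a v hv => ?_, fun p q a v hv => ?_, fun p q a v u hv hu => ?_,
    fun p q a v u hv hu => ?_, fun n a v => ?_, fun n a v => ?_, fun n a v => ?_,
    fun n a v => ?_, fun n A B hAB => isEigenfunction_SUStar n hAB⟩
  · convert isEigenfunction_SOpq a (by norm_num) (outer_mul_Ipq_of_C1 hv) hiso using 1
    ring
  · convert isEigenfunction_SOpq a (by norm_num) (outer_mul_Ipq_of_C2 hv) hiso using 1
    ring
  · refine isEigenfunction_SUpq a (by norm_num) (outer_mul_Ipq_of_C1 hv) fun h => ?_
    field_simp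
    ring
  · refine isEigenfunction_SUpq a (by norm_num) (outer_mul_Ipq_of_C2 hv) fun h => ?_
    field_simp
    ring
  · convert isEigenfunction_Sppq a (by norm_num) (outer_mul_Ipq_of_C1 hv)
      (outer_mul_Ipq_of_C1 hu) using 1
    ring
  · convert isEigenfunction_Sppq a (by norm_num) (outer_mul_Ipq_of_C2 hv)
      (outer_mul_Ipq_of_C2 hu) using 1
    ring
  · convert isEigenfunction_SpR n (a := Sum.elim a 0) v using 2 with q
    rw [outer_elim_zero, trace_fromBlocks_mul_transpose, outer_smul, Matrix.transpose_add,
      Matrix.transpose_smul, mul_add, mul_smul_comm, smul_mul_assoc]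
    simp only [zero_mul, add_zero, Matrix.trace_zero]
    rfl
  · convert isEigenfunction_SpR n (a := Sum.elim 0 a) v using 2 with q
    rw [outer_zero_elim, trace_fromBlocks_mul_transpose, outer_smul, Matrix.transpose_add,
      Matrix.transpose_smul, mul_add, mul_smul_comm, smul_mul_assoc]
    simp only [zero_mul, zero_add, Matrix.trace_zero, add_zero]
    rfl
  · convert isEigenfunction_SOStar n (Sum.elim a 0) (v := Sum.elim v 0) (δ := -1) (by norm_num)
      (outer_mul_Ipq_of_C1 fun _ => rfl) using 2 with q
    rw [outer_elim_zero, trace_fromBlocks_mul_transpose, outer_zero]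
    simp only [zero_mul, add_zero, Matrix.trace_zero]
  · convert isEigenfunction_SOStar n (Sum.elim a 0) (v := Sum.elim 0 v) (δ := 1) (by norm_num)
      (outer_mul_Ipq_of_C2 fun _ => rfl) using 2 with q
    rw [outer_elim_zero, trace_fromBlocks_mul_transpose, outer_zero]
    simp only [zero_mul, add_zero, zero_add, Matrix.trace_zero]
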